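/- Let $(X_t)_{t>0}$ be a square-integrable real process on a probability space with $E(X_t)=0$ and $E(X_tX_s)=\min\{t,s\}$ for $s,t>0$. Put $\mathcal F_{s,u}=\sigma\{X_r: r\in(0,s]\cup[u,\infty)\}$, $\mathcal F_{\le s}=\sigma\{X_r: r\in(0,s]\}$, $\Delta_{s,u}=\frac{X_u-X_s}{u-s}$, $\widetilde\Delta_{s,u}=\frac{uX_s-sX_u}{u-s}$. Suppose that $(X_t)$ is a quadratic harness with real parameters $q,\eta,\theta,\sigma,\tau$ where $\sigma=0$, i.e., for all $0<s<t<u$, almost surely $$E(X_t\mid\mathcal F_{s,u})=\frac{u-t}{u-s}X_s+\frac{t-s}{u-s}X_u,$$ $$\mathrm{Var}(X_t\mid\mathcal F_{s,u})=\frac{(u-t)(t-s)}{u+\tau-qs}\left(1+\eta\widetilde\Delta_{s,u}+\theta\Delta_{s,u}+\tau\Delta_{s,u}^2-(1-q)\Delta_{s,u}\widetilde\Delta_{s,u}\right).$$ For $n\ge 0$ let $[n]_q=1+q+\dots+q^{n-1}$, $[0]_q=0$. Assume that $-1<q\le 1$, that $1+[n]_q\eta\theta+[n]_q^2\tau\eta^2>0$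 for all $n\ge0$, and that for each $t>0$ the law of $X_t$ has infinite support. Then $X_t$ has finite moments of all orders for every $t>0$, and $(X_t)$ has monic orthogonal martingale polynomials, that is, polynomials $p_n(x;t)$, $n\ge0$, $t>0$, monic of degree $n$ in $x$, with $E(p_n(X_t;t)\mid\mathcal F_{\le s})=p_n(X_s;s)$ almost surely for $0<s<t$ and $E(p_m(X_t;t)p_n(X_t;t))=0$ for $m\ne n$, $t>0$ (all these expectations being of integrable variables). Moreover, a family of polynomials $p_n(x;t)$, $n\ge0$, $t>0$, is such a family of monic orthogonal martingale polynomials if and only if, for every $t>0$, $p_0(x;t)=1$, $p_1(x;t)=x$ and, for all $n\ge1$, $$xp_n(x;t)=p_{n+1}(x;t)+\left(\eta t+\theta+([n]_q+[n-1]_q)\eta\tau\right)[n]_q\,p_n(x;t)+(t+\tau[n-1]_q)\left(1+[n-1]_q\eta\theta+[n-1]_q^2\tau\eta^2\right)[n]_q\,p_{n-1}(x;t).$$ -/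

import Mathlib

open MeasureTheory ProbabilityTheory Polynomial

noncomputable section

namespace QuadraticHarness

/-- The `q`-number `[n]_q = 1 + q + ⋯ + q ^ (n - 1)`, with `[0]_q = 0`. -/
def qNum (q : ℝ) (n : ℕ) : ℝ := ∑ i ∈ Finset.range n, q ^ i

variable {Ω : Type*}

/-- `F_{s,u}`, the σ-field generated by the `X_r` with `r ∈ (0, s] ∪ [u, ∞)`. -/
abbrev twoSided (X : ℝ → Ω → ℝ) (s u : ℝ) : MeasurableSpace Ω :=
  ⨆ r ∈ Set.Ioc 0 s ∪ Set.Ici u, MeasurableSpace.comap (X r) inferInstance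

/-- `F_{≤ s}`, the σ-field generated by the `X_r` with `r ∈ (0, s]`. -/
abbrev past (X : ℝ → Ω → ℝ) (s : ℝ) : MeasurableSpace Ω :=
  ⨆ r ∈ Set.Ioc 0 s, MeasurableSpace.comap (X r) inferInstance

/-- `Δ_{t,u} = (X_u - X_t) / (u - t)`. -/
def Delta (X : ℝ → Ω → ℝ) (t u : ℝ) (ω : Ω) : ℝ := (X u ω - X t ω) / (u - t)

/-- `Δ̃_{t,u} = (u X_t - t X_u) / (u - t)`. -/
def DeltaTilde (X : ℝ → Ω → ℝ) (t u : ℝ) (ω : Ω) : ℝ := (u * X t ω - t * X u ω) / (u - t)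

/-- The normalizing function `F_{t,s,u} = (u - t)(t - s) / (u (1 + σ s) + τ - q s)`. -/
def normF (q σ τ t s u : ℝ) : ℝ := ((u - t) * (t - s)) / (u * (1 + σ * s) + τ - q * s)

/-- `(X_t)_{t > 0}` is a quadratic harness with parameters `q, η, θ, σ, τ`: a square integrable
process, centered with covariance `min t s`, with linear regressions and with quadratic
conditional variances. The process is indexed by `ℝ`, but only its values at `t > 0` matter. -/
structure IsQuadraticHarness [MeasurableSpace Ω] (μ : Measure Ω) (X : ℝ → Ω → ℝ)
    (q η θ σ τ : ℝ) : Prop where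
  measurable : ∀ t, 0 < t → Measurable (X t)
  memLp : ∀ t, 0 < t → MemLp (X t) 2 μ
  mean : ∀ t, 0 < t → ∫ ω, X t ω ∂μ = 0
  cov : ∀ t s, 0 < t → 0 < s → ∫ ω, X t ω * X s ω ∂μ = min t s
  condExp : ∀ s t u, 0 < s → s < t → t < u →
    μ[X t | twoSided X s u] =ᵐ[μ]
      fun ω => (u - t) / (u - s) * X s ω + (t - s) / (u - s) * X u ω
  condVar : ∀ s t u, 0 < s → s < t → t < u →
    Var[X t; μ | twoSided X s u] =ᵐ[μ]
      fun ω => normF q σ τ t s u *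
        (1 + η * DeltaTilde X s u ω + θ * Delta X s u ω
          + σ * DeltaTilde X s u ω ^ 2 + τ * Delta X s u ω ^ 2
          - (1 - q) * (Delta X s u ω * DeltaTilde X s u ω))

/-- `p n t`, for `n : ℕ` and `t > 0`, is a family of monic orthogonal martingale polynomials for
`(X_t)_{t > 0}`: `p n t` is monic of degree `n`, `(p n t)(X_t)` is a martingale in `t > 0` for
every `n`, and for every `t > 0` the `p n t` are orthogonal under the law of `X_t`. -/
structure IsMonicOrthogonalMartingale [MeasurableSpace Ω] (μ : Measure Ω) (X : ℝ → Ω → ℝ)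
    (p : ℕ → ℝ → ℝ[X]) : Prop where
  monic : ∀ n t, 0 < t → (p n t).Monic
  natDegree : ∀ n t, 0 < t → (p n t).natDegree = n
  integrable : ∀ n t, 0 < t → Integrable (fun ω => (p n t).eval (X t ω)) μ
  martingale : ∀ n s t, 0 < s → s < t →
    μ[fun ω => (p n t).eval (X t ω) | past X s] =ᵐ[μ] fun ω => (p n s).eval (X s ω)
  integrable_mul : ∀ m n t, 0 < t →
    Integrable (fun ω => (p m t).eval (X t ω) * (p n t).eval (X t ω)) μ
  orthogonal : ∀ m n t, 0 < t → m ≠ n →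
    ∫ ω, (p m t).eval (X t ω) * (p n t).eval (X t ω) ∂μ = 0

end QuadraticHarness

end

noncomputable section

namespace QuadraticHarness

/-! ### Algebra of the three-term recurrence and its q-commutation relation. -/

section Coefficients

variable (q η θ τ : ℝ)

/-! Write the recurrence operator at time t as t·x + y, where x is `mulSlope` and y is `mulConst`.
The coefficients in the theorem are those for which yx - q·xy = 1 + θx + ηy + τx² (`qCommutation`),
and this is what the quadratic conditional variance requires of multiplication by X_s, X_t, X_u
(`mulAt_quadratic`).

The martingale property goes by induction on the degree (`isMartingalePoly_add_two`). Fix s and a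
bounded test function I of the past of s. Given degrees up to m+1, let H(r) be the defect of
E[p_{m+2}(X_r) I] from its value at s. The linear regression tested on p_{m+1}(X_u) I and the
conditional variance tested on p_m(X_u) I each express H(t) as a multiple of H(u). The two factors
differ, so H vanishes. Degree one comes from letting u tend to infinity in the linear regression.

The induction needs moments. Degree two needs only square integrability and yields the variance of
X_u - X_t given the past of t; letting s tend to 0 yields the variance of X_t given X_u. Together,
with truncated powers as weights, they raise the order of finite moments by one
(`integrable_pow_succ`).

Since X_s tends to 0 in L² as s tends to 0, every p_n with n ≥ 1 has mean zero
(`integral_monicPoly_eq_zero`), and the recurrence propagates this to E[X_t^k p_n(X_t; t)] = 0 for k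
< n, that is, orthogonality. Because the laws have infinite support, monic orthogonal polynomials
are unique at each t (`monic_orthogonal_unique`), which gives the equivalence. -/

@[simp] lemma qNum_zero : qNum q 0 = 0 := by simp [qNum]

lemma qNum_succ (n : ℕ) : qNum q (n + 1) = 1 + q * qNum q n := by
  rw [qNum, Finset.sum_range_succ', qNum, Finset.mul_sum]
  simp [pow_succ', add_comm]

/-- The slope in `t` of the diagonal coefficient of the three-term recurrence. -/
def diagSlope (n : ℕ) : ℝ := η * qNum q n

/-- The value at `t = 0` of the diagonal coefficient of the three-term recurrence. -/
def diagConst (n : ℕ) : ℝ := (θ + (qNum q n + qNum q (n - 1)) * η * τ) * qNum q n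

/-- The slope in `t` of the subdiagonal coefficient of the three-term recurrence. -/
def lowSlope (n : ℕ) : ℝ :=
  (1 + qNum q (n - 1) * η * θ + qNum q (n - 1) ^ 2 * τ * η ^ 2) * qNum q n

/-- The diagonal coefficient of the three-term recurrence. -/
def diagCoeff (n : ℕ) (t : ℝ) : ℝ :=
  (η * t + θ + (qNum q n + qNum q (n - 1)) * η * τ) * qNum q n

/-- The subdiagonal coefficient of the three-term recurrence. -/
def lowCoeff (n : ℕ) (t : ℝ) : ℝ :=
  (t + τ * qNum q (n - 1))
    * (1 + qNum q (n - 1) * η * θ + qNum q (n - 1) ^ 2 * τ * η ^ 2) * qNum q n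

lemma diagCoeff_eq (n : ℕ) (t : ℝ) :
    diagCoeff q η θ τ n t = t * diagSlope q η n + diagConst q η θ τ n := by
  simp only [diagCoeff, diagSlope, diagConst]; ring

lemma lowCoeff_eq (n : ℕ) (t : ℝ) :
    lowCoeff q η θ τ n t
      = t * lowSlope q η θ τ n + τ * qNum q (n - 1) * lowSlope q η θ τ n := by
  simp only [lowCoeff, lowSlope]; ring

@[simp] lemma diagCoeff_zero (t : ℝ) : diagCoeff q η θ τ 0 t = 0 := by simp [diagCoeff]

@[simp] lemma lowCoeff_zero (t : ℝ) : lowCoeff q η θ τ 0 t = 0 := by simp [lowCoeff]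

@[simp] lemma lowCoeff_one (t : ℝ) : lowCoeff q η θ τ 1 t = t := by simp [lowCoeff, qNum_succ]

/-- If `J` lists the values of a linear functional on a basis `p_n`, then `mulSlope J` lists those
of the functional composed with the slope in `t` of the three-term recurrence operator. -/
def mulSlope (J : ℕ → ℝ) (n : ℕ) : ℝ := diagSlope q η n * J n + lowSlope q η θ τ n * J (n - 1)

/-- The analogue of `mulSlope` for the value at `t = 0` of the recurrence operator. -/
def mulConst (J : ℕ → ℝ) (n : ℕ) : ℝ :=
  J (n + 1) + diagConst q η θ τ n * J n
    + τ * qNum q (n - 1) * lowSlope q η θ τ n * J (n - 1)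

/-- The analogue of `mulSlope` for the recurrence operator at time `t`. -/
def mulAt (t : ℝ) (J : ℕ → ℝ) (n : ℕ) : ℝ :=
  J (n + 1) + diagCoeff q η θ τ n t * J n + lowCoeff q η θ τ n t * J (n - 1)

lemma mulAt_eq (t : ℝ) (J : ℕ → ℝ) (n : ℕ) :
    mulAt q η θ τ t J n = t * mulSlope q η θ τ J n + mulConst q η θ τ J n := by
  simp only [mulAt, mulSlope, mulConst, diagCoeff_eq, lowCoeff_eq]; ring

lemma mulAt_mulAt_eq (r v : ℝ) (J : ℕ → ℝ) (n : ℕ) :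
    mulAt q η θ τ v (mulAt q η θ τ r J) n
      = r * v * mulSlope q η θ τ (mulSlope q η θ τ J) n
        + r * mulConst q η θ τ (mulSlope q η θ τ J) n
        + v * mulSlope q η θ τ (mulConst q η θ τ J) n
        + mulConst q η θ τ (mulConst q η θ τ J) n := by
  rw [mulAt_eq]
  simp only [mulSlope, mulConst, mulAt_eq]; ring

/-- The `q`-commutation relation between the two parts of the recurrence operator. -/
lemma qCommutation (J : ℕ → ℝ) (n : ℕ) :
    mulConst q η θ τ (mulSlope q η θ τ J) n
      - q * mulSlope q η θ τ (mulConst q η θ τ J) n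
      = J n + θ * mulSlope q η θ τ J n + η * mulConst q η θ τ J n
        + τ * mulSlope q η θ τ (mulSlope q η θ τ J) n := by
  -- The only fact needed about q-numbers is [n+1] = 1 + q[n]. The small cases are separate because
  -- of the truncated index n - 1; at n = 0 the factor [0] = 0 kills that term.
  rcases n with _ | _ | n
  · simp [mulSlope, mulConst, diagSlope, diagConst, lowSlope, qNum_succ]
    ring
  · simp [mulSlope, mulConst, diagSlope, diagConst, lowSlope, qNum_succ]
    ring
  · simp only [mulSlope, mulConst, diagSlope, diagConst, lowSlope, qNum_succ,
      Nat.add_sub_cancel]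
    rcases n with _ | n
    · simp
      ring
    · simp only [qNum_succ]
      ring

/-- The quadratic harness relation for the products of two recurrence operators. -/
lemma mulAt_quadratic (J : ℕ → ℝ) (n : ℕ) {s t u : ℝ} (hsu : u - s ≠ 0)
    (hD : u + τ - q * s ≠ 0) :
    mulAt q η θ τ t (mulAt q η θ τ t J) n
      = ((u - t) / (u - s)) ^ 2 * mulAt q η θ τ s (mulAt q η θ τ s J) n
        + 2 * ((u - t) / (u - s)) * ((t - s) / (u - s))
          * mulAt q η θ τ u (mulAt q η θ τ s J) n
        + ((t - s) / (u - s)) ^ 2 * mulAt q η θ τ u (mulAt q η θ τ u J) n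
        + (u - t) * (t - s) / (u + τ - q * s) *
          (J n + η * ((u * mulAt q η θ τ s J n - s * mulAt q η θ τ u J n) / (u - s))
            + θ * ((mulAt q η θ τ u J n - mulAt q η θ τ s J n) / (u - s))
            + τ * ((mulAt q η θ τ u (mulAt q η θ τ u J) n
                - 2 * mulAt q η θ τ u (mulAt q η θ τ s J) n
                + mulAt q η θ τ s (mulAt q η θ τ s J) n) / (u - s) ^ 2)
            - (1 - q) * (((u + s) * mulAt q η θ τ u (mulAt q η θ τ s J) n
                - s * mulAt q η θ τ u (mulAt q η θ τ u J) n
                - u * mulAt q η θ τ s (mulAt q η θ τ s J) n) / (u - s) ^ 2)) := by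
  have h := qCommutation q η θ τ J n
  simp only [mulAt_mulAt_eq]
  simp only [mulAt_eq]
  generalize mulConst q η θ τ (mulSlope q η θ τ J) n = XY at *
  generalize mulSlope q η θ τ (mulConst q η θ τ J) n = YX at *
  generalize mulSlope q η θ τ (mulSlope q η θ τ J) n = XX at *
  generalize mulConst q η θ τ (mulConst q η θ τ J) n = YY at *
  generalize mulSlope q η θ τ J n = x at *
  generalize mulConst q η θ τ J n = y at *
  obtain h' : J n = XY - q * YX - θ * x - η * y - τ * XX := by linarith
  rw [h']
  clear h h'
  -- Trading τ for the denominator D makes D a free variable, so that clearing denominators leaves a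
  -- polynomial identity.
  obtain ⟨D, rfl⟩ : ∃ D, τ = D + q * s - u := ⟨u + τ - q * s, by ring⟩
  rw [show u + (D + q * s - u) - q * s = D by ring] at hD ⊢
  field_simp
  ring

/-- The monic polynomials given by the three-term recurrence. -/
def monicPoly : ℕ → ℝ → ℝ[X]
  | 0, _ => 1
  | 1, _ => X
  | n + 2, t => X * monicPoly (n + 1) t - C (diagCoeff q η θ τ (n + 1) t) * monicPoly (n + 1) t
      - C (lowCoeff q η θ τ (n + 1) t) * monicPoly n t

@[simp] lemma monicPoly_zero (t : ℝ) : monicPoly q η θ τ 0 t = 1 := by simp [monicPoly]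

@[simp] lemma monicPoly_one (t : ℝ) : monicPoly q η θ τ 1 t = X := by simp [monicPoly]

/-- Both coefficients vanish at n = 0, so the truncated index 0 - 1 = 0 does no harm and the
recurrence needs no exceptional case. -/
lemma X_mul_monicPoly (n : ℕ) (t : ℝ) :
    X * monicPoly q η θ τ n t = monicPoly q η θ τ (n + 1) t
      + C (diagCoeff q η θ τ n t) * monicPoly q η θ τ n t
      + C (lowCoeff q η θ τ n t) * monicPoly q η θ τ (n - 1) t := by
  rcases n with _ | n
  · simp
  · rw [monicPoly, Nat.add_sub_cancel]; ring

lemma mul_eval_monicPoly (n : ℕ) (t x : ℝ) :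
    x * (monicPoly q η θ τ n t).eval x = (monicPoly q η θ τ (n + 1) t).eval x
      + diagCoeff q η θ τ n t * (monicPoly q η θ τ n t).eval x
      + lowCoeff q η θ τ n t * (monicPoly q η θ τ (n - 1) t).eval x := by
  simpa using congrArg (eval x) (X_mul_monicPoly q η θ τ n t)

lemma monicPoly_monic_natDegree (n : ℕ) (t : ℝ) :
    (monicPoly q η θ τ n t).Monic ∧ (monicPoly q η θ τ n t).natDegree = n := by
  induction n using Nat.strong_induction_on with
  | _ n ih =>
    rcases n with _ | _ | n
    · simp
    · simp
    · obtain ⟨h1, d1⟩ := ih (n + 1) (by omega)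
      obtain ⟨h0, d0⟩ := ih n (by omega)
      have hm : (X * monicPoly q η θ τ (n + 1) t).Monic := monic_X.mul h1
      have hd : (X * monicPoly q η θ τ (n + 1) t).natDegree = n + 2 := by
        rw [monic_X.natDegree_mul h1, d1, natDegree_X]; ring
      have hr : (C (diagCoeff q η θ τ (n + 1) t) * monicPoly q η θ τ (n + 1) t
          + C (lowCoeff q η θ τ (n + 1) t) * monicPoly q η θ τ n t).natDegree
            < (X * monicPoly q η θ τ (n + 1) t).natDegree := by
        rw [hd]
        refine (natDegree_add_le _ _).trans_lt (max_lt ?_ ?_)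
        · exact (natDegree_C_mul_le _ _).trans_lt (by omega)
        · exact (natDegree_C_mul_le _ _).trans_lt (by omega)
      have he : monicPoly q η θ τ (n + 2) t = X * monicPoly q η θ τ (n + 1) t
          - (C (diagCoeff q η θ τ (n + 1) t) * monicPoly q η θ τ (n + 1) t
          + C (lowCoeff q η θ τ (n + 1) t) * monicPoly q η θ τ n t) := by
        rw [monicPoly]; ring
      rw [he]
      exact ⟨hm.sub_of_left (degree_lt_degree hr), by
        rw [natDegree_sub_eq_left_of_natDegree_lt hr, hd]⟩

end Coefficients

/-! ### Testing conditional expectations, and integrability under weights. -/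

section Integration

variable {Ω : Type*} {m0 : MeasurableSpace Ω} {μ : Measure Ω}

lemma integral_mul_of_condExp_ae_eq [IsFiniteMeasure μ] {m : MeasurableSpace Ω} (hm : m ≤ m0)
    {Z W Y : Ω → ℝ} (hZ : Integrable Z μ) (hW : μ[Z | m] =ᵐ[μ] W) (hY : StronglyMeasurable[m] Y)
    (hZY : Integrable (fun ω => Z ω * Y ω) μ) :
    ∫ ω, Z ω * Y ω ∂μ = ∫ ω, W ω * Y ω ∂μ := by
  have h := condExp_mul_of_stronglyMeasurable_right (μ := μ) hY hZY hZ
  rw [show ∫ ω, Z ω * Y ω ∂μ = ∫ ω, (Z * Y) ω ∂μ from rfl, ← integral_condExp hm]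
  refine integral_congr_ae ?_
  filter_upwards [h, hW] with ω h1 h2
  rw [h1, Pi.mul_apply, h2]

/-- The bound |f| ≤ 1 + f² replaces any boundedness of the weight Y, which will later be a
polynomial in X_u. -/
lemma integrable_mul_of_sq_mul {f Y : Ω → ℝ} (hf : AEStronglyMeasurable f μ) (hY : Integrable Y μ)
    (hfY : Integrable (fun ω => f ω ^ 2 * Y ω) μ) : Integrable (fun ω => f ω * Y ω) μ := by
  refine (hY.norm.add hfY.norm).mono' (hf.mul hY.1) (.of_forall fun ω => ?_)
  simp only [Pi.add_apply, norm_mul, Real.norm_eq_abs, abs_pow, sq_abs]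
  have h : |f ω| ≤ 1 + f ω ^ 2 := by nlinarith [sq_abs (f ω), sq_nonneg (|f ω| - 1)]
  nlinarith [abs_nonneg (Y ω)]

lemma integrable_mul_mul_of_sq_mul {f g Y : Ω → ℝ} (hf : AEStronglyMeasurable f μ)
    (hg : AEStronglyMeasurable g μ) (hY : AEStronglyMeasurable Y μ)
    (hfY : Integrable (fun ω => f ω ^ 2 * Y ω) μ) (hgY : Integrable (fun ω => g ω ^ 2 * Y ω) μ) :
    Integrable (fun ω => f ω * g ω * Y ω) μ := by
  refine (hfY.norm.add hgY.norm).mono' ((hf.mul hg).mul hY) (.of_forall fun ω => ?_)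
  simp only [Pi.add_apply, norm_mul, Real.norm_eq_abs, abs_pow, sq_abs]
  have h : |f ω| * |g ω| ≤ f ω ^ 2 + g ω ^ 2 := by
    nlinarith [sq_abs (f ω), sq_abs (g ω), sq_nonneg (|f ω| - |g ω|), sq_nonneg (f ω),
      sq_nonneg (g ω)]
  nlinarith [abs_nonneg (Y ω)]

lemma integral_linComb_six {f₁ f₂ f₃ f₄ f₅ f₆ : Ω → ℝ} (h₁ : Integrable f₁ μ)
    (h₂ : Integrable f₂ μ) (h₃ : Integrable f₃ μ) (h₄ : Integrable f₄ μ) (h₅ : Integrable f₅ μ)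
    (h₆ : Integrable f₆ μ) (c₁ c₂ c₃ c₄ c₅ c₆ : ℝ) :
    ∫ ω, (c₁ * f₁ ω + c₂ * f₂ ω + c₃ * f₃ ω + c₄ * f₄ ω + c₅ * f₅ ω + c₆ * f₆ ω) ∂μ
      = c₁ * ∫ ω, f₁ ω ∂μ + c₂ * ∫ ω, f₂ ω ∂μ + c₃ * ∫ ω, f₃ ω ∂μ + c₄ * ∫ ω, f₄ ω ∂μ
        + c₅ * ∫ ω, f₅ ω ∂μ + c₆ * ∫ ω, f₆ ω ∂μ := by
  have i₁ := h₁.const_mul c₁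
  have i₂ : Integrable (fun ω => c₁ * f₁ ω + c₂ * f₂ ω) μ := i₁.add (h₂.const_mul c₂)
  have i₃ : Integrable (fun ω => c₁ * f₁ ω + c₂ * f₂ ω + c₃ * f₃ ω) μ := i₂.add (h₃.const_mul c₃)
  have i₄ : Integrable (fun ω => c₁ * f₁ ω + c₂ * f₂ ω + c₃ * f₃ ω + c₄ * f₄ ω) μ :=
    i₃.add (h₄.const_mul c₄)
  have i₅ : Integrable (fun ω => c₁ * f₁ ω + c₂ * f₂ ω + c₃ * f₃ ω + c₄ * f₄ ω + c₅ * f₅ ω) μ :=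
    i₄.add (h₅.const_mul c₅)
  rw [integral_add i₅ (h₆.const_mul c₆), integral_add i₄ (h₅.const_mul c₅),
    integral_add i₃ (h₄.const_mul c₄), integral_add i₂ (h₃.const_mul c₃),
    integral_add i₁ (h₂.const_mul c₂)]
  simp only [integral_const_mul]

/-- The Cauchy-Schwarz inequality for integrals of products. -/
lemma abs_integral_mul_le {f g : Ω → ℝ} (hf : MemLp f 2 μ) (hg : MemLp g 2 μ) :
    |∫ ω, f ω * g ω ∂μ| ≤ √(∫ ω, f ω ^ 2 ∂μ) * √(∫ ω, g ω ^ 2 ∂μ) := by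
  have hfg : Integrable (fun ω => f ω * g ω) μ := hf.integrable_mul hg
  have hf2 := hf.integrable_sq
  have hg2 := hg.integrable_sq
  have h : ∀ x : ℝ, 0 ≤ (∫ ω, f ω ^ 2 ∂μ) * (x * x) + 2 * (∫ ω, f ω * g ω ∂μ) * x
      + ∫ ω, g ω ^ 2 ∂μ := by
    intro x
    have e : (∫ ω, f ω ^ 2 ∂μ) * (x * x) + 2 * (∫ ω, f ω * g ω ∂μ) * x + ∫ ω, g ω ^ 2 ∂μ
        = ∫ ω, (x * f ω + g ω) ^ 2 ∂μ := by
      have h1 : ∫ ω, (x * f ω + g ω) ^ 2 ∂μ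
          = ∫ ω, (x * x) * f ω ^ 2 + (2 * x) * (f ω * g ω) + g ω ^ 2 ∂μ := by
        congr 1; ext ω; ring
      have i1 := hf2.const_mul (x * x)
      have i2 := hfg.const_mul (2 * x)
      have i12 : Integrable (fun ω => (x * x) * f ω ^ 2 + (2 * x) * (f ω * g ω)) μ := i1.add i2
      rw [h1, integral_add i12 hg2, integral_add i1 i2, integral_const_mul, integral_const_mul]
      ring
    rw [e]
    exact integral_nonneg fun ω => sq_nonneg _
  have hd := discrim_le_zero h
  rw [discrim] at hd
  rw [← Real.sqrt_mul (integral_nonneg fun ω => sq_nonneg _)]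
  exact Real.abs_le_sqrt (by nlinarith)

end Integration

/-! ### The regressions of the harness in integrated form. -/

section Harness

variable {Ω : Type*}

lemma past_mono (X : ℝ → Ω → ℝ) {s t : ℝ} (hst : s ≤ t) : past X s ≤ past X t :=
  biSup_mono fun _ hr => ⟨hr.1, hr.2.trans hst⟩

lemma past_le_twoSided (X : ℝ → Ω → ℝ) (s u : ℝ) : past X s ≤ twoSided X s u :=
  biSup_mono fun _ hr => Or.inl hr

lemma measurable_past (X : ℝ → Ω → ℝ) {r s : ℝ} (h0 : 0 < r) (h : r ≤ s) :
    Measurable[past X s] (X r) :=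
  Measurable.of_comap_le
    (le_biSup (fun r => MeasurableSpace.comap (X r) inferInstance) (Set.mem_Ioc.2 ⟨h0, h⟩))

lemma measurable_twoSided_right (X : ℝ → Ω → ℝ) (s u : ℝ) : Measurable[twoSided X s u] (X u) :=
  Measurable.of_comap_le
    (le_biSup (fun r => MeasurableSpace.comap (X r) inferInstance)
      (show u ∈ Set.Ioc 0 s ∪ Set.Ici u from Or.inr Set.self_mem_Ici))

variable [m0 : MeasurableSpace Ω] {μ : Measure Ω} {X : ℝ → Ω → ℝ} {q η θ τ : ℝ}

namespace IsQuadraticHarness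

variable (hX : IsQuadraticHarness μ X q η θ 0 τ)
include hX

lemma past_le (s : ℝ) : past X s ≤ m0 :=
  iSup₂_le fun r hr => (hX.measurable r hr.1).comap_le

lemma twoSided_le {s u : ℝ} (hu : 0 < u) : twoSided X s u ≤ m0 :=
  iSup₂_le fun r hr => (hX.measurable r (hr.elim (fun h => h.1) fun h => hu.trans_le h)).comap_le

lemma integral_sq {t : ℝ} (ht : 0 < t) : ∫ ω, X t ω ^ 2 ∂μ = t := by
  simpa [sq] using hX.cov t t ht ht

lemma aesm {t : ℝ} (ht : 0 < t) : AEStronglyMeasurable (X t) μ :=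
  (hX.measurable t ht).aestronglyMeasurable

variable [IsProbabilityMeasure μ]

/-- The linear regression, tested against a function measurable with respect to `F_{s,u}`. -/
lemma integral_mul_eq {s t u : ℝ} (hs : 0 < s) (hst : s < t) (htu : t < u) {Y : Ω → ℝ}
    (hY : StronglyMeasurable[twoSided X s u] Y) (hsY : Integrable (fun ω => X s ω * Y ω) μ)
    (htY : Integrable (fun ω => X t ω * Y ω) μ) (huY : Integrable (fun ω => X u ω * Y ω) μ) :
    ∫ ω, X t ω * Y ω ∂μ = (u - t) / (u - s) * ∫ ω, X s ω * Y ω ∂μ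
      + (t - s) / (u - s) * ∫ ω, X u ω * Y ω ∂μ := by
  have ht : 0 < t := hs.trans hst
  rw [integral_mul_of_condExp_ae_eq (hX.twoSided_le (ht.trans htu))
    ((hX.memLp t ht).integrable one_le_two) (hX.condExp s t u hs hst htu) hY htY,
    ← integral_const_mul, ← integral_const_mul,
    ← integral_add (hsY.const_mul _) (huY.const_mul _)]
  congr 1; ext ω; ring

/-- The quadratic conditional variance, tested against a function measurable with respect to
`F_{s,u}`. -/
lemma integral_sq_mul_eq {s t u : ℝ} (hs : 0 < s) (hst : s < t) (htu : t < u) {Y : Ω → ℝ}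
    (hY : StronglyMeasurable[twoSided X s u] Y) (hYi : Integrable Y μ)
    (hsY : Integrable (fun ω => X s ω ^ 2 * Y ω) μ)
    (htY : Integrable (fun ω => X t ω ^ 2 * Y ω) μ)
    (huY : Integrable (fun ω => X u ω ^ 2 * Y ω) μ) :
    ∫ ω, X t ω ^ 2 * Y ω ∂μ
      = ((u - t) / (u - s)) ^ 2 * ∫ ω, X s ω ^ 2 * Y ω ∂μ
        + 2 * ((u - t) / (u - s)) * ((t - s) / (u - s)) * ∫ ω, X s ω * X u ω * Y ω ∂μ
        + ((t - s) / (u - s)) ^ 2 * ∫ ω, X u ω ^ 2 * Y ω ∂μ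
        + (u - t) * (t - s) / (u + τ - q * s) *
          (∫ ω, Y ω ∂μ
            + η * ((u * ∫ ω, X s ω * Y ω ∂μ - s * ∫ ω, X u ω * Y ω ∂μ) / (u - s))
            + θ * ((∫ ω, X u ω * Y ω ∂μ - ∫ ω, X s ω * Y ω ∂μ) / (u - s))
            + τ * ((∫ ω, X u ω ^ 2 * Y ω ∂μ - 2 * ∫ ω, X s ω * X u ω * Y ω ∂μ
                + ∫ ω, X s ω ^ 2 * Y ω ∂μ) / (u - s) ^ 2)
            - (1 - q) * (((u + s) * ∫ ω, X s ω * X u ω * Y ω ∂μ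
                - s * ∫ ω, X u ω ^ 2 * Y ω ∂μ
                - u * ∫ ω, X s ω ^ 2 * Y ω ∂μ) / (u - s) ^ 2)) := by
  have ht : 0 < t := hs.trans hst
  have hu : 0 < u := ht.trans htu
  have hsu : u - s ≠ 0 := by linarith
  have hle := hX.twoSided_le (s := s) hu
  have hsY1 := integrable_mul_of_sq_mul (hX.aesm hs) hYi hsY
  have huY1 := integrable_mul_of_sq_mul (hX.aesm hu) hYi huY
  have hsuY := integrable_mul_mul_of_sq_mul (hX.aesm hs) (hX.aesm hu) hYi.1 hsY huY
  -- The conditional second moment is the conditional variance plus the square of the linear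
  -- regression.
  have hc : μ[X t ^ 2 | twoSided X s u] =ᵐ[μ] fun ω =>
      ((u - t) / (u - s) * X s ω + (t - s) / (u - s) * X u ω) ^ 2
        + (u - t) * (t - s) / (u + τ - q * s) *
        (1 + η * DeltaTilde X s u ω + θ * Delta X s u ω + τ * Delta X s u ω ^ 2
          - (1 - q) * (Delta X s u ω * DeltaTilde X s u ω)) := by
    filter_upwards [hX.condExp s t u hs hst htu, hX.condVar s t u hs hst htu,
      condVar_ae_eq_condExp_sq_sub_sq_condExp hle (hX.memLp t ht)] with ω h1 h2 h3
    rw [h2] at h3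
    simp only [Pi.sub_apply, Pi.pow_apply, h1, normF, zero_mul, add_zero, mul_one] at h3
    linarith
  have ht2 : Integrable (X t ^ 2) μ := (hX.memLp t ht).integrable_sq
  have htest := integral_mul_of_condExp_ae_eq hle ht2 hc hY htY
  simp only [Pi.pow_apply] at htest
  rw [htest]
  set N := (u - t) * (t - s) / (u + τ - q * s) with hN
  have key := integral_linComb_six (μ := μ) hsY hsuY huY hsY1 huY1 hYi
    (((u - t) / (u - s)) ^ 2 + N * (τ / (u - s) ^ 2 + (1 - q) * u / (u - s) ^ 2))
    (2 * ((u - t) / (u - s)) * ((t - s) / (u - s))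
      - N * (2 * τ / (u - s) ^ 2 + (1 - q) * (u + s) / (u - s) ^ 2))
    (((t - s) / (u - s)) ^ 2 + N * (τ / (u - s) ^ 2 + (1 - q) * s / (u - s) ^ 2))
    (N * (η * u / (u - s) - θ / (u - s))) (N * (θ / (u - s) - η * s / (u - s))) N
  calc _ = _ := by
        congr 1; ext ω
        simp only [Delta, DeltaTilde]
        generalize u - s = d
        ring
    _ = _ := key
    _ = _ := by generalize u - s = d; ring

end IsQuadraticHarness
end Harness

/-! ### Integrability of polynomials in two random variables. -/

section Integration

variable {Ω : Type*} {m0 : MeasurableSpace Ω} {μ : Measure Ω}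

lemma pow_mul_pow_le_one_add {x y : ℝ} (hx : 0 ≤ x) (hy : 0 ≤ y) {i j N : ℕ} (h : i + j ≤ N) :
    x ^ i * y ^ j ≤ 1 + x ^ N + y ^ N := by
  set M := max 1 (max x y) with hM
  have h1 : 1 ≤ M := le_max_left _ _
  have hxM : x ≤ M := (le_max_left x y).trans (le_max_right _ _)
  have hyM : y ≤ M := (le_max_right x y).trans (le_max_right _ _)
  have hb : x ^ i * y ^ j ≤ M ^ N :=
    calc x ^ i * y ^ j ≤ M ^ i * M ^ j := by gcongr
      _ = M ^ (i + j) := (pow_add _ _ _).symm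
      _ ≤ M ^ N := pow_le_pow_right₀ h1 h
  have hx' := pow_nonneg hx N
  have hy' := pow_nonneg hy N
  refine hb.trans ?_
  rcases max_choice 1 (max x y) with h | h
  · rw [hM, h, one_pow]; linarith
  · rcases max_choice x y with h' | h' <;> rw [hM, h, h'] <;> linarith

lemma integrable_pow_mul_pow [IsFiniteMeasure μ] {f g : Ω → ℝ} (hf : AEStronglyMeasurable f μ)
    (hg : AEStronglyMeasurable g μ) {N : ℕ} (hfN : Integrable (fun ω => f ω ^ N) μ)
    (hgN : Integrable (fun ω => g ω ^ N) μ) {i j : ℕ} (h : i + j ≤ N) :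
    Integrable (fun ω => f ω ^ i * g ω ^ j) μ := by
  refine (((integrable_const (1 : ℝ)).add hfN.norm).add hgN.norm).mono'
    ((hf.pow i).mul (hg.pow j)) (.of_forall fun ω => ?_)
  simp only [Pi.add_apply, norm_mul, norm_pow, Real.norm_eq_abs]
  exact pow_mul_pow_le_one_add (abs_nonneg _) (abs_nonneg _) h

lemma integrable_eval_mul_pow [IsFiniteMeasure μ] {f g : Ω → ℝ} (hf : AEStronglyMeasurable f μ)
    (hg : AEStronglyMeasurable g μ) {N : ℕ} (hfN : Integrable (fun ω => f ω ^ N) μ)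
    (hgN : Integrable (fun ω => g ω ^ N) μ) {P : ℝ[X]} {i : ℕ} (h : i + P.natDegree ≤ N) :
    Integrable (fun ω => P.eval (g ω) * f ω ^ i) μ := by
  simp only [eval_eq_sum_range, Finset.sum_mul]
  refine integrable_finsetSum _ fun k hk => ?_
  have hk' := Finset.mem_range_succ_iff.1 hk
  have := (integrable_pow_mul_pow hf hg hfN hgN (i := i) (j := k) (by omega)).const_mul (P.coeff k)
  refine this.congr (.of_forall fun ω => ?_)
  simp only
  ring

end Integration

/-! ### Sign of τ, and the martingale property in degrees zero and one. -/

section Harness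

variable {Ω : Type*} [m0 : MeasurableSpace Ω] {μ : Measure Ω} {X : ℝ → Ω → ℝ} {q η θ τ : ℝ}

/-- The martingale property of the `n`-th polynomial of the recurrence. -/
def IsMartingalePoly (μ : Measure Ω) (X : ℝ → Ω → ℝ) (q η θ τ : ℝ) (n : ℕ) : Prop :=
  ∀ s t, 0 < s → s < t →
    μ[fun ω => (monicPoly q η θ τ n t).eval (X t ω) | past X s]
      =ᵐ[μ] fun ω => (monicPoly q η θ τ n s).eval (X s ω)

namespace IsQuadraticHarness

variable (hX : IsQuadraticHarness μ X q η θ 0 τ) [IsProbabilityMeasure μ]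
include hX

/-- Division by zero returns 0, so a vanishing denominator would make the conditional variance zero.
At the midpoint this would force E X_t² = (3s + u)/4 instead of (s + u)/2. -/
lemma denom_ne_zero {s u : ℝ} (hs : 0 < s) (hsu : s < u) : u + τ - q * s ≠ 0 := by
  intro h0
  have hu := hs.trans hsu
  have hm : 0 < (s + u) / 2 := by positivity
  have h := hX.integral_sq_mul_eq hs (t := (s + u) / 2) (u := u) (by linarith) (by linarith)
    (Y := fun _ => 1) stronglyMeasurable_const (integrable_const _)
    (by simpa using (hX.memLp s hs).integrable_sq) (by simpa using (hX.memLp _ hm).integrable_sq)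
    (by simpa using (hX.memLp u hu).integrable_sq)
  simp only [mul_one, hX.integral_sq hs, hX.integral_sq hm, hX.integral_sq hu, hX.cov s u hs hu,
    h0, div_zero, zero_mul, add_zero, min_eq_left hsu.le] at h
  have hd : u - s ≠ 0 := by linarith
  field_simp at h
  nlinarith [sq_nonneg (u - s), mul_pos (sub_pos.2 hsu) (mul_pos (sub_pos.2 hsu) (sub_pos.2 hsu))]

/-- If τ < 0, the choice s = -τ/(2 - q), u = 2s makes the denominator u + τ - qs vanish. -/
lemma tau_nonneg (hq1 : q ≤ 1) : 0 ≤ τ := by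
  by_contra! h
  have h2 : 0 < 2 - q := by linarith
  have hs : 0 < -τ / (2 - q) := div_pos (by linarith) h2
  refine hX.denom_ne_zero (s := -τ / (2 - q)) (u := q * (-τ / (2 - q)) - τ) hs ?_ (by ring)
  have : -τ / (2 - q) * (2 - q) = -τ := div_mul_cancel₀ _ h2.ne'
  nlinarith

lemma integral_eval_mul_eq {k : ℕ} (hk : IsMartingalePoly μ X q η θ τ k) {r u : ℝ} (hr : 0 < r)
    (hru : r ≤ u) {Y : Ω → ℝ} (hY : StronglyMeasurable[past X r] Y)
    (hi : Integrable (fun ω => (monicPoly q η θ τ k u).eval (X u ω)) μ)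
    (hiY : Integrable (fun ω => (monicPoly q η θ τ k u).eval (X u ω) * Y ω) μ) :
    ∫ ω, (monicPoly q η θ τ k u).eval (X u ω) * Y ω ∂μ
      = ∫ ω, (monicPoly q η θ τ k r).eval (X r ω) * Y ω ∂μ := by
  rcases hru.eq_or_lt with rfl | hru
  · rfl
  · exact integral_mul_of_condExp_ae_eq (hX.past_le r) hi (hk r u hr hru) hY hiY

/-- Indicators of past events are among the test functions bounded by 1, and they determine the
conditional expectation. -/
lemma isMartingalePoly_of_integral {n : ℕ}
    (hi : ∀ t, 0 < t → Integrable (fun ω => (monicPoly q η θ τ n t).eval (X t ω)) μ)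
    (h : ∀ s t, 0 < s → s < t → ∀ I : Ω → ℝ, StronglyMeasurable[past X s] I → (∀ ω, |I ω| ≤ 1) →
      ∫ ω, (monicPoly q η θ τ n t).eval (X t ω) * I ω ∂μ
        = ∫ ω, (monicPoly q η θ τ n s).eval (X s ω) * I ω ∂μ) :
    IsMartingalePoly μ X q η θ τ n := by
  intro s t hs hst
  have hle := hX.past_le s
  refine (ae_eq_condExp_of_forall_setIntegral_eq hle (hi t (hs.trans hst))
    (fun A _ _ => (hi s hs).integrableOn) (fun A hA _ => ?_) ?_).symm
  · have key := h s t hs hst (A.indicator fun _ => 1)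
      ((@stronglyMeasurable_const _ _ (past X s) _ 1).indicator hA)
      (fun ω => by by_cases hω : ω ∈ A <;> simp [hω])
    have e : ∀ r, ∫ ω in A, (monicPoly q η θ τ n r).eval (X r ω) ∂μ
        = ∫ ω, (monicPoly q η θ τ n r).eval (X r ω) * A.indicator (fun _ => (1 : ℝ)) ω ∂μ := by
      intro r
      rw [← integral_indicator (hle _ hA)]
      congr 1; ext ω
      by_cases hω : ω ∈ A <;> simp [hω]
    rw [e, e, key]
  · have : Measurable[past X s] fun ω => (monicPoly q η θ τ n s).eval (X s ω) :=
      (monicPoly q η θ τ n s).continuous.measurable.comp (measurable_past X hs le_rfl)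
    exact this.stronglyMeasurable.aestronglyMeasurable

lemma isMartingalePoly_zero : IsMartingalePoly μ X q η θ τ 0 := by
  intro s t hs hst
  simp [condExp_const (hX.past_le s)]

/-- In the linear regression X_u carries the weight (t - s)/(u - s), while its L² norm is only √u.
Its contribution disappears as u tends to infinity, leaving X_s. -/
lemma isMartingalePoly_one : IsMartingalePoly μ X q η θ τ 1 := by
  refine hX.isMartingalePoly_of_integral
    (fun t ht => by simpa using (hX.memLp t ht).integrable one_le_two) fun s t hs hst I hI hb => ?_
  simp only [monicPoly_one, eval_X]
  have hI0 : AEStronglyMeasurable I μ := (hI.mono (hX.past_le s)).aestronglyMeasurable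
  have hb' : ∀ᵐ ω ∂μ, ‖I ω‖ ≤ 1 := .of_forall hb
  have hI2 : MemLp I 2 μ := MemLp.of_bound hI0 1 hb'
  have hi : ∀ r, 0 < r → Integrable (fun ω => X r ω * I ω) μ := fun r hr =>
    ((hX.memLp r hr).integrable one_le_two).mul_bdd hI0 hb'
  have hbd : ∀ r, 0 < r → |∫ ω, X r ω * I ω ∂μ| ≤ √r := by
    intro r hr
    refine (abs_integral_mul_le (hX.memLp r hr) hI2).trans ?_
    rw [hX.integral_sq hr]
    refine mul_le_of_le_one_right (Real.sqrt_nonneg _) (Real.sqrt_le_one.2 ?_)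
    calc ∫ ω, I ω ^ 2 ∂μ ≤ ∫ _, (1 : ℝ) ∂μ :=
          integral_mono hI2.integrable_sq (integrable_const _)
            fun ω => (sq_le_one_iff_abs_le_one _).2 (hb ω)
      _ = 1 := by simp
  have ht := hs.trans hst
  set a := ∫ ω, X s ω * I ω ∂μ
  set b := ∫ ω, X t ω * I ω ∂μ
  have hlim : ∀ u, t < u → |b - a| * (u - s) ≤ (t - s) * (√u + √s) := by
    intro u hu
    have h := hX.integral_mul_eq hs hst hu (hI.mono (past_le_twoSided X s u)) (hi s hs) (hi t ht)
      (hi u (ht.trans hu))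
    have hd : 0 < u - s := by linarith
    have e : (b - a) * (u - s) = (t - s) * (∫ ω, X u ω * I ω ∂μ - a) := by
      rw [show b = _ from h]; field_simp; ring
    rw [← abs_of_pos hd, ← abs_mul, e, abs_mul, abs_of_pos (by linarith : 0 < t - s)]
    gcongr
    exact (abs_sub _ _).trans (add_le_add (hbd u (ht.trans hu)) (hbd s hs))
  by_contra hne
  have hpos : 0 < |b - a| := abs_pos.2 (sub_ne_zero.2 hne)
  set K := |b - a|
  -- With u = v² the bound becomes K(v² - s) ≤ (t - s)(v + √s); this v is large enough to violate
  -- it.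
  set v := t + 1 + ((t - s) / K) + (s * K + (t - s) * √s) / K with hv
  have hst' : 0 < t - s := by linarith
  have hKv : K * v = K * t + K + (t - s) + (s * K + (t - s) * √s) := by
    rw [hv]; field_simp
  have h1 : 0 ≤ (t - s) / K := by positivity
  have h2 : 0 ≤ (s * K + (t - s) * √s) / K := by positivity
  have hv1 : t + 1 ≤ v := by linarith
  have h := hlim (v ^ 2) (by nlinarith)
  rw [Real.sqrt_sq (by linarith)] at h
  have h3 : 0 ≤ (t - s) * √s := by positivity
  nlinarith [mul_pos hpos ht, mul_pos hs hpos]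

end IsQuadraticHarness
end Harness

/-! ### The induction step for the martingale property. -/

section Step

variable {Ω : Type*} [m0 : MeasurableSpace Ω] {μ : Measure Ω} {X : ℝ → Ω → ℝ} {q η θ τ : ℝ}

namespace IsQuadraticHarness

/-- This is the passage from probability to algebra: inserting a factor X_v under the integral acts
as `mulAt` on the list of integrals. -/
lemma integral_recurrence (k : ℕ) (v : ℝ) {G : Ω → ℝ}
    (h₁ : Integrable (fun ω => (monicPoly q η θ τ (k + 1) v).eval (X v ω) * G ω) μ)
    (h₂ : Integrable (fun ω => (monicPoly q η θ τ k v).eval (X v ω) * G ω) μ)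
    (h₃ : Integrable (fun ω => (monicPoly q η θ τ (k - 1) v).eval (X v ω) * G ω) μ) :
    ∫ ω, (monicPoly q η θ τ k v).eval (X v ω) * (X v ω * G ω) ∂μ
      = mulAt q η θ τ v (fun j => ∫ ω, (monicPoly q η θ τ j v).eval (X v ω) * G ω ∂μ) k := by
  have h₁₂ : Integrable (fun ω => (monicPoly q η θ τ (k + 1) v).eval (X v ω) * G ω
      + diagCoeff q η θ τ k v * ((monicPoly q η θ τ k v).eval (X v ω) * G ω)) μ :=
    h₁.add (h₂.const_mul _)
  simp only [mulAt]
  rw [← integral_const_mul, ← integral_const_mul, ← integral_add h₁ (h₂.const_mul _),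
    ← integral_add h₁₂ (h₃.const_mul _)]
  congr 1; ext ω
  linear_combination G ω * mul_eval_monicPoly q η θ τ k v (X v ω)

variable (hX : IsQuadraticHarness μ X q η θ 0 τ) [IsProbabilityMeasure μ]
include hX

lemma integrable_eval_mul_pow_mul {N : ℕ}
    (hN : ∀ t, 0 < t → Integrable (fun ω => X t ω ^ N) μ) {I : Ω → ℝ}
    (hI : AEStronglyMeasurable I μ) (hb : ∀ ω, |I ω| ≤ 1) {k i : ℕ} (h : k + i ≤ N) {v r : ℝ}
    (hv : 0 < v) (hr : 0 < r) :
    Integrable (fun ω => (monicPoly q η θ τ k v).eval (X v ω) * (X r ω ^ i * I ω)) μ := by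
  have hk := (monicPoly_monic_natDegree q η θ τ k v).2
  have := (integrable_eval_mul_pow (hX.aesm hr) (hX.aesm hv) (hN r hr) (hN v hv)
    (P := monicPoly q η θ τ k v) (i := i) (by omega)).mul_bdd hI (.of_forall hb)
  simpa only [mul_assoc] using this

/-- If the polynomials of degree at most `m + 1` have the martingale property and the moments of
order `m + 2` are finite, then the polynomial of degree `m + 2` has the martingale property. -/
lemma isMartingalePoly_add_two (m : ℕ)
    (hN : ∀ t, 0 < t → Integrable (fun ω => X t ω ^ (m + 2)) μ)
    (hM : ∀ k ≤ m + 1, IsMartingalePoly μ X q η θ τ k) :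
    IsMartingalePoly μ X q η θ τ (m + 2) := by
  have hpi : ∀ k ≤ m + 2, ∀ v, 0 < v →
      Integrable (fun ω => (monicPoly q η θ τ k v).eval (X v ω)) μ := by
    intro k hk v hv
    simpa using hX.integrable_eval_mul_pow_mul hN (I := fun _ => 1) aestronglyMeasurable_const
      (by simp) (k := k) (i := 0) (by omega) hv hv
  refine hX.isMartingalePoly_of_integral (hpi _ le_rfl) fun s t hs hst I hI hb => ?_
  obtain ⟨u, htu⟩ : ∃ u, t < u := ⟨t + 1, by linarith⟩
  have ht := hs.trans hst
  have hu := ht.trans htu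
  have hsu := hst.trans htu
  have hI0 : AEStronglyMeasurable I μ := (hI.mono (hX.past_le s)).aestronglyMeasurable
  have i0 : ∀ k ≤ m + 2, ∀ v, 0 < v →
      Integrable (fun ω => (monicPoly q η θ τ k v).eval (X v ω) * I ω) μ := fun k hk v hv => by
    simpa using hX.integrable_eval_mul_pow_mul hN hI0 hb (k := k) (i := 0) (by omega) hv hv
  have i1 : ∀ k ≤ m + 1, ∀ v r, 0 < v → 0 < r →
      Integrable (fun ω => (monicPoly q η θ τ k v).eval (X v ω) * (X r ω * I ω)) μ :=
    fun k hk v r hv hr => by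
    simpa using hX.integrable_eval_mul_pow_mul hN hI0 hb (k := k) (i := 1) (by omega) hv hr
  have i2 : ∀ v r, 0 < v → 0 < r →
      Integrable (fun ω => (monicPoly q η θ τ m v).eval (X v ω) * (X r ω ^ 2 * I ω)) μ :=
    fun v r hv hr => hX.integrable_eval_mul_pow_mul hN hI0 hb (by omega) hv hr
  set J : ℕ → ℝ := fun k => ∫ ω, (monicPoly q η θ τ k s).eval (X s ω) * I ω ∂μ with hJ
  -- H is the defect of the martingale property in the top degree. It enters the identities below
  -- with coefficient 1, the polynomials being monic.
  set H : ℝ → ℝ := fun r =>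
    ∫ ω, (monicPoly q η θ τ (m + 2) r).eval (X r ω) * I ω ∂μ - J (m + 2) with hH
  have hHs : H s = 0 := by simp [hH, hJ]
  suffices H t = 0 by simpa [hH, hJ, sub_eq_zero] using this
  have hpos : ∀ {r}, s ≤ r → 0 < r := fun hr => hs.trans_le hr
  have e0 : ∀ k ≤ m + 1, ∀ r, s ≤ r →
      ∫ ω, (monicPoly q η θ τ k r).eval (X r ω) * I ω ∂μ = J k := fun k hk r hr =>
    hX.integral_eval_mul_eq (hM k hk) hs hr hI (hpi k (by omega) r (hpos hr))
      (i0 k (by omega) r (hpos hr))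
  have e1 : ∀ k ≤ m, ∀ r, s ≤ r →
      ∫ ω, (monicPoly q η θ τ k r).eval (X r ω) * (X r ω * I ω) ∂μ = mulAt q η θ τ r J k := by
    intro k hk r hr
    rw [integral_recurrence k r (i0 _ (by omega) r (hpos hr)) (i0 _ (by omega) r (hpos hr))
      (i0 _ (by omega) r (hpos hr))]
    simp only [mulAt, e0 (k + 1) (by omega) r hr, e0 k (by omega) r hr,
      e0 (k - 1) (by omega) r hr]
  have e1' : ∀ r, s ≤ r →
      ∫ ω, (monicPoly q η θ τ (m + 1) r).eval (X r ω) * (X r ω * I ω) ∂μ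
        = mulAt q η θ τ r J (m + 1) + H r := by
    intro r hr
    rw [integral_recurrence (m + 1) r (i0 _ (by omega) r (hpos hr)) (i0 _ (by omega) r (hpos hr))
      (i0 _ (by omega) r (hpos hr))]
    simp only [mulAt, Nat.add_sub_cancel, e0 (m + 1) le_rfl r hr, e0 m (by omega) r hr, hH]
    ring
  have e2 : ∀ r, s ≤ r →
      ∫ ω, (monicPoly q η θ τ m r).eval (X r ω) * (X r ω ^ 2 * I ω) ∂μ
        = mulAt q η θ τ r (mulAt q η θ τ r J) m + H r := by
    intro r hr
    have := integral_recurrence (μ := μ) (X := X) (q := q) (η := η) (θ := θ) (τ := τ) m r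
      (G := fun ω => X r ω * I ω) (i1 _ (by omega) r r (hpos hr) (hpos hr))
      (i1 _ (by omega) r r (hpos hr) (hpos hr)) (i1 _ (by omega) r r (hpos hr) (hpos hr))
    simp only [sq, mul_assoc]
    rw [this]
    simp only [mulAt, e1' r hr, e1 m le_rfl r hr, e1 (m - 1) (by omega) r hr]
    ring
  have mI : ∀ r, s ≤ r → StronglyMeasurable[past X r] I := fun r hr => hI.mono (past_mono X hr)
  have mX : ∀ r, s ≤ r → StronglyMeasurable[past X r] (X r) := fun r hr =>
    (measurable_past X (hpos hr) le_rfl).stronglyMeasurable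
  have tr1 : ∀ k ≤ m + 1, ∀ r, s ≤ r → r ≤ u →
      ∫ ω, (monicPoly q η θ τ k u).eval (X u ω) * (X r ω * I ω) ∂μ
        = ∫ ω, (monicPoly q η θ τ k r).eval (X r ω) * (X r ω * I ω) ∂μ := fun k hk r hr hru =>
    hX.integral_eval_mul_eq (hM k hk) (hpos hr) hru ((mX r hr).mul (mI r hr))
      (hpi k (by omega) u hu) (i1 k hk u r hu (hpos hr))
  have tr2 : ∀ r, s ≤ r → r ≤ u →
      ∫ ω, (monicPoly q η θ τ m u).eval (X u ω) * (X r ω ^ 2 * I ω) ∂μ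
        = ∫ ω, (monicPoly q η θ τ m r).eval (X r ω) * (X r ω ^ 2 * I ω) ∂μ := fun r hr hru =>
    hX.integral_eval_mul_eq (hM m (by omega)) (hpos hr) hru (((mX r hr).pow 2).mul (mI r hr))
      (hpi m (by omega) u hu) (i2 u r hu (hpos hr))
  have cross : ∫ ω, (monicPoly q η θ τ m u).eval (X u ω) * (X u ω * (X s ω * I ω)) ∂μ
      = mulAt q η θ τ u (mulAt q η θ τ s J) m + 0 := by
    rw [integral_recurrence (μ := μ) m u (G := fun ω => X s ω * I ω)
      (i1 _ (by omega) u s hu hs) (i1 _ (by omega) u s hu hs) (i1 _ (by omega) u s hu hs)]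
    simp only [mulAt, tr1 (m + 1) le_rfl s le_rfl hsu.le, tr1 m (by omega) s le_rfl hsu.le,
      tr1 (m - 1) (by omega) s le_rfl hsu.le, e1' s le_rfl, e1 m le_rfl s le_rfl,
      e1 (m - 1) (by omega) s le_rfl, hHs]
    ring
  have mT : ∀ k, StronglyMeasurable[twoSided X s u]
      fun ω => (monicPoly q η θ τ k u).eval (X u ω) * I ω := fun k =>
    ((monicPoly q η θ τ k u).continuous.measurable.comp
      (measurable_twoSided_right X s u)).stronglyMeasurable.mul (hI.mono (past_le_twoSided X s u))
  have comm1 : ∀ k r, (fun ω => X r ω * ((monicPoly q η θ τ k u).eval (X u ω) * I ω))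
      = fun ω => (monicPoly q η θ τ k u).eval (X u ω) * (X r ω * I ω) := fun k r => by
    ext ω; ring
  have comm2 : ∀ r, (fun ω => X r ω ^ 2 * ((monicPoly q η θ τ m u).eval (X u ω) * I ω))
      = fun ω => (monicPoly q η θ τ m u).eval (X u ω) * (X r ω ^ 2 * I ω) := fun r => by
    ext ω; ring
  have comm3 : (fun ω => X s ω * X u ω * ((monicPoly q η θ τ m u).eval (X u ω) * I ω))
      = fun ω => (monicPoly q η θ τ m u).eval (X u ω) * (X u ω * (X s ω * I ω)) := by
    ext ω; ring
  -- The test degrees m + 1 and m are chosen so that, after multiplication by one or two factors X,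
  -- both identities reach degree m + 2 exactly.
  have hlin := hX.integral_mul_eq hs hst htu (mT (m + 1))
    (by rw [comm1]; exact i1 _ le_rfl u s hu hs) (by rw [comm1]; exact i1 _ le_rfl u t hu ht)
    (by rw [comm1]; exact i1 _ le_rfl u u hu hu)
  have hquad := hX.integral_sq_mul_eq hs hst htu (mT m) (i0 m (by omega) u hu)
    (by rw [comm2]; exact i2 u s hu hs) (by rw [comm2]; exact i2 u t hu ht)
    (by rw [comm2]; exact i2 u u hu hu)
  simp only [comm1, tr1 _ le_rfl s le_rfl hsu.le, tr1 _ le_rfl t hst.le htu.le, e1' s le_rfl,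
    e1' t hst.le, e1' u hsu.le, hHs, mulAt_eq] at hlin
  simp only [comm1, comm2, comm3, tr2 s le_rfl hsu.le, tr2 t hst.le htu.le, e2 s le_rfl,
    e2 t hst.le, e2 u hsu.le, hHs, cross, e0 m (by omega) u hsu.le,
    tr1 m (by omega) s le_rfl hsu.le, e1 m le_rfl s le_rfl, e1 m le_rfl u hsu.le] at hquad
  have hD := hX.denom_ne_zero hs hsu
  have hd : u - s ≠ 0 := by linarith
  rw [mulAt_quadratic q η θ τ J m (t := t) hd hD] at hquad
  clear_value H J
  have h1 : H t = (t - s) / (u - s) * H u := by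
    field_simp at hlin ⊢
    linarith
  have h2 : H t = (((t - s) / (u - s)) ^ 2
      + (u - t) * (t - s) / (u + τ - q * s) * ((τ + (1 - q) * s) / (u - s) ^ 2)) * H u := by
    linear_combination hquad
  -- The two factors of H u differ by (t - s)(u - t)/((u - s)D) with D = u + τ - qs, which is
  -- nonzero.
  have h3 : H u = 0 := by
    have h5 := h1.symm.trans h2
    obtain ⟨D, hDe⟩ : ∃ D, τ = D + q * s - u := ⟨u + τ - q * s, by ring⟩
    rw [hDe, show u + (D + q * s - u) - q * s = D by ring] at h5
    rw [hDe, show u + (D + q * s - u) - q * s = D by ring] at hD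
    have h4 : (t - s) * (u - t) / ((u - s) * D) * H u = 0 := by
      rw [← sub_eq_zero] at h5
      rw [← h5]
      field_simp
      ring
    refine (mul_eq_zero.1 h4).resolve_left (div_ne_zero (mul_ne_zero ?_ ?_) (mul_ne_zero hd hD)) <;>
      linarith
  rw [h1, h3, mul_zero]

end IsQuadraticHarness
end Step

/-! ### One-sided conditional variances. -/

section Moments

open Filter Topology

variable {Ω : Type*} [m0 : MeasurableSpace Ω] {μ : Measure Ω} {X : ℝ → Ω → ℝ} {q η θ τ : ℝ}

namespace IsQuadraticHarness

variable (hX : IsQuadraticHarness μ X q η θ 0 τ)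
include hX

lemma integrable_sq_mul_bdd {t : ℝ} (ht : 0 < t) {Y : Ω → ℝ} {M : ℝ}
    (hY : AEStronglyMeasurable Y μ) (hb : ∀ ω, |Y ω| ≤ M) :
    Integrable (fun ω => X t ω ^ 2 * Y ω) μ :=
  (hX.memLp t ht).integrable_sq.mul_bdd hY (.of_forall hb)

/-- By Cauchy-Schwarz and E X_s² = s. This plays the role of the missing initial value X_0 = 0. -/
lemma tendsto_integral_mul_zero {Z : Ω → ℝ} (hZ : MemLp Z 2 μ) :
    Tendsto (fun s => ∫ ω, X s ω * Z ω ∂μ) (𝓝[>] 0) (𝓝 0) := by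
  refine squeeze_zero_norm' (a := fun s => √s * √(∫ ω, Z ω ^ 2 ∂μ)) ?_ ?_
  · filter_upwards [self_mem_nhdsWithin] with s hs
    have := abs_integral_mul_le (hX.memLp s hs) hZ
    rwa [hX.integral_sq hs] at this
  · have : Tendsto (fun s => √s * √(∫ ω, Z ω ^ 2 ∂μ)) (𝓝 0) (𝓝 (√0 * √(∫ ω, Z ω ^ 2 ∂μ))) :=
      (Real.continuous_sqrt.mul continuous_const).tendsto 0
    rw [Real.sqrt_zero, zero_mul] at this
    exact this.mono_left nhdsWithin_le_nhds

variable [IsProbabilityMeasure μ]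

/-- The conditional variance of an increment given the past. -/
lemma integral_sub_sq_mul {t u : ℝ} (ht : 0 < t) (htu : t < u) {h : ℝ → ℝ} {M : ℝ}
    (hm : Measurable h) (hb : ∀ x, |h x| ≤ M) :
    ∫ ω, (X u ω - X t ω) ^ 2 * h (X t ω) ∂μ
      = (u - t) * (∫ ω, h (X t ω) ∂μ + η * ∫ ω, X t ω * h (X t ω) ∂μ) := by
  have hu := ht.trans htu
  have hY : StronglyMeasurable[past X t] fun ω => h (X t ω) :=
    (hm.comp (measurable_past X ht le_rfl)).stronglyMeasurable
  have hXt : StronglyMeasurable[past X t] (X t) :=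
    (measurable_past X ht le_rfl).stronglyMeasurable
  have hY0 : AEStronglyMeasurable (fun ω => h (X t ω)) μ :=
    (hY.mono (hX.past_le t)).aestronglyMeasurable
  have hYi : Integrable (fun ω => h (X t ω)) μ := Integrable.of_bound hY0 M (.of_forall fun ω => hb _)
  have i2 : ∀ v, 0 < v → Integrable (fun ω => X v ω ^ 2 * h (X t ω)) μ := fun v hv =>
    hX.integrable_sq_mul_bdd hv hY0 fun ω => hb _
  have i1 : ∀ v, 0 < v → Integrable (fun ω => X v ω * h (X t ω)) μ := fun v hv =>
    integrable_mul_of_sq_mul (hX.aesm hv) hYi (i2 v hv)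
  have i11 : Integrable (fun ω => X u ω * X t ω * h (X t ω)) μ :=
    integrable_mul_mul_of_sq_mul (hX.aesm hu) (hX.aesm ht) hY0 (i2 u hu) (i2 t ht)
  have hi : ∀ v, 0 < v → Integrable (X v) μ := fun v hv => (hX.memLp v hv).integrable one_le_two
  -- Degree two needs only second moments, so no circularity arises with the finiteness of higher
  -- moments.
  have hM2 := hX.isMartingalePoly_add_two 0 (fun v hv => (hX.memLp v hv).integrable_sq)
    fun k hk => by
      interval_cases k
      exacts [hX.isMartingalePoly_zero, hX.isMartingalePoly_one]
  have p2 : ∀ v, 0 < v → ∀ G : Ω → ℝ, Integrable (fun ω => X v ω ^ 2 * G ω) μ →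
      Integrable (fun ω => X v ω * G ω) μ → Integrable G μ →
      Integrable (fun ω => (monicPoly q η θ τ 2 v).eval (X v ω) * G ω) μ := by
    intro v hv G h2 h1 h0
    refine ((h2.sub (h1.const_mul (diagCoeff q η θ τ 1 v))).sub
      (h0.const_mul (lowCoeff q η θ τ 1 v))).congr (.of_forall fun ω => ?_)
    have := mul_eval_monicPoly q η θ τ 1 v (X v ω)
    simp only [monicPoly_one, eval_X, Nat.sub_self, monicPoly_zero, eval_one] at this
    simp only [Pi.sub_apply]
    linear_combination G ω * this
  have hrec : ∀ v, 0 < v → ∫ ω, X v ω ^ 2 * h (X t ω) ∂μ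
      = ∫ ω, (monicPoly q η θ τ 2 v).eval (X v ω) * h (X t ω) ∂μ
        + diagCoeff q η θ τ 1 v * ∫ ω, X v ω * h (X t ω) ∂μ
        + v * (∫ ω, h (X t ω) ∂μ) := by
    intro v hv
    have := integral_recurrence (μ := μ) (X := X) (q := q) (η := η) (θ := θ) (τ := τ) 1 v
      (G := fun ω => h (X t ω)) (p2 v hv _ (i2 v hv) (i1 v hv) hYi) (by simpa using i1 v hv)
      (by simpa using hYi)
    simp only [mulAt, monicPoly_one, monicPoly_zero, eval_X, eval_one, Nat.sub_self, one_mul,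
      lowCoeff_one, Nat.reduceAdd, ← mul_assoc, ← sq] at this
    exact this
  have hp2 : Integrable (fun ω => (monicPoly q η θ τ 2 u).eval (X u ω)) μ := by
    simpa using p2 u hu (fun _ => 1) (by simpa using (hX.memLp u hu).integrable_sq)
      (by simpa using hi u hu) (integrable_const _)
  have m2 := hX.integral_eval_mul_eq hM2 ht htu.le hY
    hp2
    (p2 u hu _ (i2 u hu) (i1 u hu) hYi)
  have m1 := hX.integral_eval_mul_eq hX.isMartingalePoly_one ht htu.le hY
    (by simpa using hi u hu) (by simpa using i1 u hu)
  have m11 := hX.integral_eval_mul_eq hX.isMartingalePoly_one ht htu.le (hXt.mul hY)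
    (by simpa using hi u hu) (by simpa [mul_assoc] using i11)
  simp only [monicPoly_one, eval_X, Pi.mul_apply, ← mul_assoc, ← sq] at m1 m11
  have e := integral_linComb_six (i2 u hu) i11 (i2 t ht) hYi hYi hYi 1 (-2) 1 0 0 0
  have e' : ∫ ω, (X u ω - X t ω) ^ 2 * h (X t ω) ∂μ = ∫ ω, (1 * (X u ω ^ 2 * h (X t ω))
      + -2 * (X u ω * X t ω * h (X t ω)) + 1 * (X t ω ^ 2 * h (X t ω)) + 0 * h (X t ω)
      + 0 * h (X t ω) + 0 * h (X t ω)) ∂μ := by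
    congr 1; ext ω; ring
  have r1 := hrec u hu
  have r2 := hrec t ht
  have d1 : diagCoeff q η θ τ 1 u - diagCoeff q η θ τ 1 t = η * (u - t) := by
    simp [diagCoeff, qNum_succ]; ring
  rw [e', e, m11, r1, m2, m1, r2]
  linear_combination (∫ ω, X t ω * h (X t ω) ∂μ) * d1

/-- The conditional variance of `X_t` given the future. -/
lemma integral_sub_mul_sq_mul (hq1 : q ≤ 1) {t u : ℝ} (ht : 0 < t) (htu : t < u) {g : ℝ → ℝ}
    {M : ℝ} (hm : Measurable g) (hb : ∀ x, |g x| ≤ M) :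
    ∫ ω, (X t ω - t / u * X u ω) ^ 2 * g (X u ω) ∂μ
      = t * (u - t) / (u + τ) * (∫ ω, g (X u ω) ∂μ + θ / u * ∫ ω, X u ω * g (X u ω) ∂μ
          + τ / u ^ 2 * ∫ ω, X u ω ^ 2 * g (X u ω) ∂μ) := by
  have hu := ht.trans htu
  have hτ := hX.tau_nonneg hq1
  have huτ : u + τ ≠ 0 := by positivity
  have hY0 : AEStronglyMeasurable (fun ω => g (X u ω)) μ :=
    (hm.comp (hX.measurable u hu)).aestronglyMeasurable
  have hYb : ∀ᵐ ω ∂μ, ‖g (X u ω)‖ ≤ M := .of_forall fun ω => hb _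
  have hYi : Integrable (fun ω => g (X u ω)) μ := Integrable.of_bound hY0 M hYb
  have hY2 : MemLp (fun ω => g (X u ω)) 2 μ := MemLp.of_bound hY0 M hYb
  have i2 : ∀ v, 0 < v → Integrable (fun ω => X v ω ^ 2 * g (X u ω)) μ := fun v hv =>
    hX.integrable_sq_mul_bdd hv hY0 fun ω => hb _
  have i1 : ∀ v, 0 < v → Integrable (fun ω => X v ω * g (X u ω)) μ := fun v hv =>
    integrable_mul_of_sq_mul (hX.aesm hv) hYi (i2 v hv)
  have i11 : ∀ v, 0 < v → Integrable (fun ω => X v ω * X u ω * g (X u ω)) μ := fun v hv =>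
    integrable_mul_mul_of_sq_mul (hX.aesm hv) (hX.aesm hu) hY0 (i2 v hv) (i2 u hu)
  have hZ : MemLp (fun ω => X u ω * g (X u ω)) 2 μ := by
    refine MemLp.of_le_mul (c := M) (hX.memLp u hu) ((hX.aesm hu).mul hY0)
      (.of_forall fun ω => ?_)
    rw [norm_mul, mul_comm]
    exact mul_le_mul_of_nonneg_right (hb _) (norm_nonneg _)
  -- The two-sided regressions are to be passed to the limit s → 0; every integral containing X_s
  -- tends to 0.
  have la : Tendsto (fun s => ∫ ω, X s ω ^ 2 * g (X u ω) ∂μ) (𝓝[>] 0) (𝓝 0) := by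
    refine squeeze_zero_norm' (a := fun s => s * M) ?_ ?_
    · filter_upwards [self_mem_nhdsWithin] with s hs
      calc ‖∫ ω, X s ω ^ 2 * g (X u ω) ∂μ‖ ≤ ∫ ω, ‖X s ω ^ 2 * g (X u ω)‖ ∂μ :=
            norm_integral_le_integral_norm _
        _ ≤ ∫ ω, X s ω ^ 2 * M ∂μ := by
            refine integral_mono (i2 s hs).norm ((hX.memLp s hs).integrable_sq.mul_const _) fun ω => ?_
            simp only [norm_mul, norm_pow, Real.norm_eq_abs, sq_abs]
            exact mul_le_mul_of_nonneg_left (hb _) (sq_nonneg _)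
        _ = s * M := by rw [integral_mul_const, hX.integral_sq hs]
    · have : Tendsto (fun s : ℝ => s * M) (𝓝 0) (𝓝 (0 * M)) :=
        (continuous_id.mul continuous_const).tendsto 0
      rw [zero_mul] at this
      exact this.mono_left nhdsWithin_le_nhds
  have lb : Tendsto (fun s => ∫ ω, X s ω * X u ω * g (X u ω) ∂μ) (𝓝[>] 0) (𝓝 0) := by
    simpa only [mul_assoc] using hX.tendsto_integral_mul_zero hZ
  have lx := hX.tendsto_integral_mul_zero hY2
  have ls : Tendsto (fun s : ℝ => s) (𝓝[>] 0) (𝓝 0) := tendsto_id.mono_left nhdsWithin_le_nhds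
  have hmem : ∀ᶠ s in 𝓝[>] (0 : ℝ), s ∈ Set.Ioo 0 t := Ioo_mem_nhdsGT ht
  have mT : ∀ s, StronglyMeasurable[twoSided X s u] fun ω => g (X u ω) := fun s =>
    (hm.comp (measurable_twoSided_right X s u)).stronglyMeasurable
  set c := ∫ ω, X u ω ^ 2 * g (X u ω) ∂μ with hc
  set z := ∫ ω, X u ω * g (X u ω) ∂μ with hz
  set y := ∫ ω, g (X u ω) ∂μ with hy
  have hlin : ∫ ω, X t ω * X u ω * g (X u ω) ∂μ = t / u * c := by
    have hF : ContinuousAt (fun p : ℝ × ℝ => (u - t) / (u - p.1) * p.2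
        + (t - p.1) / (u - p.1) * c) (0, 0) := by
      have h0 : u - (0 : ℝ) ≠ 0 := by simpa using hu.ne'
      fun_prop (disch := assumption)
    have hT := hF.tendsto.comp (ls.prodMk_nhds lb)
    simp only [sub_zero, mul_zero, zero_add] at hT
    refine tendsto_nhds_unique (tendsto_const_nhds.congr' ?_) hT
    filter_upwards [hmem] with s hs
    have := hX.integral_mul_eq hs.1 hs.2 htu
      ((measurable_twoSided_right X s u).stronglyMeasurable.mul (mT s))
      (by simpa only [Pi.mul_apply, mul_assoc] using i11 s hs.1)
      (by simpa only [Pi.mul_apply, mul_assoc] using i11 t ht)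
      (by simpa only [Pi.mul_apply, mul_assoc] using i11 u hu)
    simp only [Pi.mul_apply, ← mul_assoc] at this
    rw [this, Function.comp_apply, hc]
    simp only [sq]
  have hquad : ∫ ω, X t ω ^ 2 * g (X u ω) ∂μ = (t / u) ^ 2 * c
      + t * (u - t) / (u + τ) * (y + θ / u * z + τ / u ^ 2 * c) := by
    have hF : ContinuousAt (fun p : ℝ × ℝ × ℝ × ℝ =>
        ((u - t) / (u - p.1)) ^ 2 * p.2.1
        + 2 * ((u - t) / (u - p.1)) * ((t - p.1) / (u - p.1)) * p.2.2.1
        + ((t - p.1) / (u - p.1)) ^ 2 * c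
        + (u - t) * (t - p.1) / (u + τ - q * p.1) *
          (y + η * ((u * p.2.2.2 - p.1 * z) / (u - p.1)) + θ * ((z - p.2.2.2) / (u - p.1))
            + τ * ((c - 2 * p.2.2.1 + p.2.1) / (u - p.1) ^ 2)
            - (1 - q) * (((u + p.1) * p.2.2.1 - p.1 * c - u * p.2.1) / (u - p.1) ^ 2)))
        (0, 0, 0, 0) := by
      have h0 : u - (0 : ℝ) ≠ 0 := by simpa using hu.ne'
      have h1 : u + τ - q * (0 : ℝ) ≠ 0 := by simpa using huτ
      have h2 : (u - (0 : ℝ)) ^ 2 ≠ 0 := pow_ne_zero 2 h0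
      fun_prop (disch := assumption)
    have hT := hF.tendsto.comp (ls.prodMk_nhds (la.prodMk_nhds (lb.prodMk_nhds lx)))
    have hval : ∀ {a b : ℝ}, Tendsto (fun s => ∫ ω, X t ω ^ 2 * g (X u ω) ∂μ) (𝓝[>] (0 : ℝ)) (𝓝 a) →
        a = b → ∫ ω, X t ω ^ 2 * g (X u ω) ∂μ = b := fun h e =>
      (tendsto_nhds_unique tendsto_const_nhds h).trans e
    refine hval (hT.congr' ?_) ?_
    · filter_upwards [hmem] with s hs
      exact (hX.integral_sq_mul_eq hs.1 hs.2 htu (mT s) hYi (i2 s hs.1) (i2 t ht) (i2 u hu)).symm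
    · simp only [sub_zero, mul_zero, zero_mul, zero_add, add_zero]
      field_simp
      ring
  have e := integral_linComb_six (i2 t ht) (i11 t ht) (i2 u hu) hYi hYi hYi
    1 (-2 * (t / u)) ((t / u) ^ 2) 0 0 0
  calc _ = _ := by congr 1; ext ω; ring
    _ = _ := e
    _ = _ := by rw [hlin, hquad]; ring

end IsQuadraticHarness
end Moments

/-! ### Finiteness of all moments. -/

section AllMoments

open Filter Topology

variable {Ω : Type*} [m0 : MeasurableSpace Ω] {μ : Measure Ω} {X : ℝ → Ω → ℝ} {q η θ τ : ℝ}

/-- The truncated power `min |x| M ^ k`. -/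
def truncPow (k : ℕ) (M x : ℝ) : ℝ := min |x| M ^ k

lemma measurable_truncPow (k : ℕ) (M : ℝ) : Measurable (truncPow k M) :=
  (measurable_norm.min measurable_const).pow_const k

lemma truncPow_nonneg (k : ℕ) {M : ℝ} (hM : 0 ≤ M) (x : ℝ) : 0 ≤ truncPow k M x :=
  pow_nonneg (le_min (abs_nonneg x) hM) k

lemma truncPow_le (k : ℕ) {M : ℝ} (hM : 0 ≤ M) (x : ℝ) : truncPow k M x ≤ M ^ k :=
  pow_le_pow_left₀ (le_min (abs_nonneg x) hM) (min_le_right _ _) k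

lemma abs_truncPow_le (k : ℕ) {M : ℝ} (hM : 0 ≤ M) (x : ℝ) : |truncPow k M x| ≤ M ^ k := by
  rw [abs_of_nonneg (truncPow_nonneg k hM x)]
  exact truncPow_le k hM x

lemma truncPow_le_abs_pow (k : ℕ) {M : ℝ} (hM : 0 ≤ M) (x : ℝ) : truncPow k M x ≤ |x| ^ k :=
  pow_le_pow_left₀ (le_min (abs_nonneg x) hM) (min_le_left _ _) k

lemma truncPow_mono (k : ℕ) {M x y : ℝ} (hM : 0 ≤ M) (h : |x| ≤ |y|) :
    truncPow k M x ≤ truncPow k M y :=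
  pow_le_pow_left₀ (le_min (abs_nonneg x) hM) (min_le_min_right M h) k

/-- If `y` is not close to `x / 2`, the first term dominates; otherwise `y` is comparable with `x`
and far from it, and the second term dominates. -/
lemma sq_mul_truncPow_le (k : ℕ) {M c : ℝ} (hM : 0 ≤ M) (hc : 0 < c) (hc2 : c < 1 / 2) (x y : ℝ) :
    x ^ 2 * truncPow k M x ≤ (y - 1 / 2 * x) ^ 2 * truncPow k M x / c ^ 2
      + (x - y) ^ 2 * truncPow k M (y / (1 / 2 - c)) / (1 / 2 - c) ^ 2 := by
  have hr : 0 < 1 / 2 - c := by linarith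
  have g0 := truncPow_nonneg k hM x
  have g1 := truncPow_nonneg k hM (y / (1 / 2 - c))
  rcases le_or_gt (c * |x|) |y - 1 / 2 * x| with h | h
  · have h1 : c ^ 2 * x ^ 2 ≤ (y - 1 / 2 * x) ^ 2 := by
      rw [← sq_abs x, ← sq_abs (y - 1 / 2 * x), ← mul_pow]
      gcongr
    have h2 : x ^ 2 * truncPow k M x ≤ (y - 1 / 2 * x) ^ 2 * truncPow k M x / c ^ 2 := by
      rw [le_div_iff₀ (by positivity)]
      nlinarith
    have : 0 ≤ (x - y) ^ 2 * truncPow k M (y / (1 / 2 - c)) / (1 / 2 - c) ^ 2 := by positivity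
    linarith
  · have hy : (1 / 2 - c) * |x| ≤ |y| := by
      have := abs_sub_abs_le_abs_sub (1 / 2 * x) y
      rw [abs_sub_comm, abs_mul, abs_of_pos (by norm_num : (0 : ℝ) < 1 / 2)] at this
      linarith
    have hxy : (1 / 2 - c) * |x| ≤ |x - y| := by
      have := abs_sub_abs_le_abs_sub (1 / 2 * x) (y - 1 / 2 * x)
      rw [abs_mul, abs_of_pos (by norm_num : (0 : ℝ) < 1 / 2),
        show 1 / 2 * x - (y - 1 / 2 * x) = x - y by ring] at this
      linarith
    have h1 : (1 / 2 - c) ^ 2 * x ^ 2 ≤ (x - y) ^ 2 := by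
      rw [← sq_abs x, ← sq_abs (x - y), ← mul_pow]
      gcongr
    have h2 : truncPow k M x ≤ truncPow k M (y / (1 / 2 - c)) := by
      refine truncPow_mono k hM ?_
      rw [abs_div, abs_of_pos hr, le_div_iff₀ hr]
      linarith
    have h3 : x ^ 2 * truncPow k M x
        ≤ (x - y) ^ 2 * truncPow k M (y / (1 / 2 - c)) / (1 / 2 - c) ^ 2 := by
      rw [le_div_iff₀ (by positivity)]
      calc x ^ 2 * truncPow k M x * (1 / 2 - c) ^ 2
          = ((1 / 2 - c) ^ 2 * x ^ 2) * truncPow k M x := by ring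
        _ ≤ (x - y) ^ 2 * truncPow k M (y / (1 / 2 - c)) := by gcongr
    have : 0 ≤ (y - 1 / 2 * x) ^ 2 * truncPow k M x / c ^ 2 := by positivity
    linarith

namespace IsQuadraticHarness

variable (hX : IsQuadraticHarness μ X q η θ 0 τ) [IsProbabilityMeasure μ]
include hX

/-- Weighted by a truncated k-th power, X_u² is bounded by the two one-sided variances at t = u/2.
These involve moments of order at most k + 1, except for the τ term, which returns the quantity
being estimated with a factor below 1 and can be absorbed. The bound is uniform in the truncation
level. -/
lemma integrable_pow_succ (hq1 : q ≤ 1) (k : ℕ)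
    (hk : ∀ t, 0 < t → Integrable (fun ω => X t ω ^ (k + 1)) μ) {u : ℝ} (hu : 0 < u) :
    Integrable (fun ω => X u ω ^ (k + 2)) μ := by
  have hτ := hX.tau_nonneg hq1
  have hut : 0 < u / 2 := by positivity
  have hlt : u / 2 < u := by linarith
  set t := u / 2 with ht
  obtain ⟨ρ, hρ⟩ : ∃ ρ, ρ = τ / (u + τ) := ⟨_, rfl⟩
  have hρ0 : 0 ≤ ρ := by rw [hρ]; positivity
  have hρ1 : ρ < 1 := by rw [hρ, div_lt_one (by positivity)]; linarith
  -- The absorbed factor is ρ/(4c²) = 4ρ/(1 + ρ)², which is below 1 because ρ ≠ 1; also c < 1/2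
  -- because ρ < 1.
  set c := (1 + ρ) / 4 with hc
  have hc0 : 0 < c := by positivity
  have hc2 : c < 1 / 2 := by rw [hc]; linarith
  set r := 1 / 2 - c with hr
  have hr0 : 0 < r := by linarith
  have iabs : ∀ v, 0 < v → ∀ j ≤ k + 1, Integrable (fun ω => |X v ω| ^ j) μ := fun v hv j hj => by
    simpa using (integrable_pow_mul_pow (hX.aesm hv) (hX.aesm hv) (hk v hv) (hk v hv)
      (i := j) (j := 0) (by omega)).norm
  set a₀ := ∫ ω, |X u ω| ^ k ∂μ
  set a₁ := ∫ ω, |X u ω| ^ (k + 1) ∂μ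
  set b₀ := ∫ ω, |X t ω| ^ k ∂μ
  set b₁ := ∫ ω, |X t ω| ^ (k + 1) ∂μ
  set K := u ^ 2 / (4 * (u + τ)) * (a₀ + |θ| / u * a₁) / c ^ 2
    + (u - t) * (b₀ / r ^ k + |η| * (b₁ / r ^ k)) / r ^ 2 with hK
  have hκ : 0 < 1 - ρ / 4 / c ^ 2 := by
    rw [sub_pos, div_lt_one (by positivity), hc]
    nlinarith [sq_nonneg (1 - ρ), sq_pos_of_pos (sub_pos.2 hρ1)]
  have hbound : ∀ M : ℕ, Integrable (fun ω => X u ω ^ 2 * truncPow k M (X u ω)) μ ∧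
      ∫ ω, X u ω ^ 2 * truncPow k M (X u ω) ∂μ ≤ K / (1 - ρ / 4 / c ^ 2) := by
    intro M
    have hM : (0 : ℝ) ≤ M := Nat.cast_nonneg M
    have mg := measurable_truncPow k (M : ℝ)
    have bg := abs_truncPow_le k hM
    have mh : Measurable fun x : ℝ => truncPow k (M : ℝ) (x / r) :=
      mg.comp (measurable_id.div_const r)
    have bh : ∀ x : ℝ, |truncPow k (M : ℝ) (x / r)| ≤ (M : ℝ) ^ k := fun x => bg _
    have mgX : ∀ v, 0 < v → AEStronglyMeasurable (fun ω => truncPow k (M : ℝ) (X v ω)) μ :=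
      fun v hv => (mg.comp (hX.measurable v hv)).aestronglyMeasurable
    have mhX : AEStronglyMeasurable (fun ω => truncPow k (M : ℝ) (X t ω / r)) μ :=
      (mh.comp (hX.measurable t hut)).aestronglyMeasurable
    have iA := hX.integrable_sq_mul_bdd hu (mgX u hu) fun ω => bg _
    refine ⟨iA, ?_⟩
    have V := hX.integral_sub_mul_sq_mul hq1 hut hlt mg bg
    have W := hX.integral_sub_sq_mul hut hlt mh bh
    have htu : t / u = 1 / 2 := by rw [ht]; field_simp
    rw [htu] at V
    set A := ∫ ω, X u ω ^ 2 * truncPow k M (X u ω) ∂μ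
    have L1 : MemLp (fun ω => X t ω - 1 / 2 * X u ω) 2 μ :=
      (hX.memLp t hut).sub ((hX.memLp u hu).const_mul _)
    have L2 : MemLp (fun ω => X u ω - X t ω) 2 μ := (hX.memLp u hu).sub (hX.memLp t hut)
    have iV : Integrable (fun ω => (X t ω - 1 / 2 * X u ω) ^ 2 * truncPow k M (X u ω)) μ :=
      L1.integrable_sq.mul_bdd (mgX u hu) (.of_forall fun ω => bg _)
    have iW : Integrable (fun ω => (X u ω - X t ω) ^ 2 * truncPow k M (X t ω / r)) μ :=
      L2.integrable_sq.mul_bdd mhX (.of_forall fun ω => bg _)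
    have ig : ∫ ω, truncPow k M (X u ω) ∂μ ≤ a₀ :=
      integral_mono (Integrable.of_bound (mgX u hu) _ (.of_forall fun ω => bg _))
        (iabs u hu k (by omega)) fun ω => truncPow_le_abs_pow k hM _
    have ixg : |∫ ω, X u ω * truncPow k M (X u ω) ∂μ| ≤ a₁ := by
      refine abs_integral_le_integral_abs.trans (integral_mono ?_ (iabs u hu _ le_rfl) fun ω => ?_)
      · exact (((hX.memLp u hu).integrable one_le_two).mul_bdd (mgX u hu)
          (.of_forall fun ω => bg _)).norm
      · simp only [abs_mul, abs_of_nonneg (truncPow_nonneg k hM _), pow_succ']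
        exact mul_le_mul_of_nonneg_left (truncPow_le_abs_pow k hM _) (abs_nonneg _)
    have hle : ∀ x : ℝ, truncPow k M (x / r) ≤ |x| ^ k / r ^ k := fun x => by
      refine (truncPow_le_abs_pow k hM _).trans_eq ?_
      rw [abs_div, abs_of_pos hr0, div_pow]
    have ih : ∫ ω, truncPow k M (X t ω / r) ∂μ ≤ b₀ / r ^ k := by
      rw [← integral_div]
      exact integral_mono (Integrable.of_bound mhX _ (.of_forall fun ω => bg _))
        ((iabs t hut k (by omega)).div_const _) fun ω => hle _
    have ixh : |∫ ω, X t ω * truncPow k M (X t ω / r) ∂μ| ≤ b₁ / r ^ k := by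
      rw [← integral_div]
      refine abs_integral_le_integral_abs.trans
        (integral_mono ?_ ((iabs t hut _ le_rfl).div_const _) fun ω => ?_)
      · exact (((hX.memLp t hut).integrable one_le_two).mul_bdd mhX
          (.of_forall fun ω => bg _)).norm
      · simp only [abs_mul, abs_of_nonneg (truncPow_nonneg k hM _), pow_succ', mul_div_assoc]
        exact mul_le_mul_of_nonneg_left (hle _) (abs_nonneg _)
    have hA : A ≤ (∫ ω, (X t ω - 1 / 2 * X u ω) ^ 2 * truncPow k M (X u ω) ∂μ) / c ^ 2
        + (∫ ω, (X u ω - X t ω) ^ 2 * truncPow k M (X t ω / r) ∂μ) / r ^ 2 := by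
      rw [← integral_div, ← integral_div, ← integral_add (iV.div_const _) (iW.div_const _)]
      exact integral_mono iA ((iV.div_const _).add (iW.div_const _))
        fun ω => sq_mul_truncPow_le k hM hc0 hc2 _ _
    have hθ : θ / u * ∫ ω, X u ω * truncPow k M (X u ω) ∂μ ≤ |θ| / u * a₁ := by
      refine (le_abs_self _).trans ?_
      rw [abs_mul, abs_div, abs_of_pos hu]
      gcongr
    have hη : η * ∫ ω, X t ω * truncPow k M (X t ω / r) ∂μ ≤ |η| * (b₁ / r ^ k) := by
      refine (le_abs_self _).trans ?_
      rw [abs_mul]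
      gcongr
    have hV : ∫ ω, (X t ω - 1 / 2 * X u ω) ^ 2 * truncPow k M (X u ω) ∂μ
        ≤ u ^ 2 / (4 * (u + τ)) * (a₀ + |θ| / u * a₁) + ρ / 4 * A := by
      have e : t * (u - t) / (u + τ) = u ^ 2 / (4 * (u + τ)) := by
        rw [ht]; field_simp; ring
      have e2 : u ^ 2 / (4 * (u + τ)) * (τ / u ^ 2 * A) = ρ / 4 * A := by
        rw [hρ]; field_simp
      rw [V, e, mul_add, e2]
      gcongr
    have hW : ∫ ω, (X u ω - X t ω) ^ 2 * truncPow k M (X t ω / r) ∂μ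
        ≤ (u - t) * (b₀ / r ^ k + |η| * (b₁ / r ^ k)) := by
      rw [W]
      have : 0 ≤ u - t := by linarith
      gcongr
    rw [le_div_iff₀ hκ]
    have h1 : A ≤ (u ^ 2 / (4 * (u + τ)) * (a₀ + |θ| / u * a₁) + ρ / 4 * A) / c ^ 2
        + (u - t) * (b₀ / r ^ k + |η| * (b₁ / r ^ k)) / r ^ 2 := hA.trans (by gcongr)
    rw [hK]
    rw [add_div] at h1
    linarith [show A * (1 - ρ / 4 / c ^ 2) = A - ρ / 4 * A / c ^ 2 by ring]
  -- On |X_u| ≤ M the truncation is inactive, so the uniform bound passes to the untruncated moment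
  -- by exhaustion.
  have hcov : AECover μ atTop fun M : ℕ => {ω | |X u ω| ≤ M} :=
    { ae_eventually_mem := .of_forall fun ω => by
        obtain ⟨N, hN⟩ := exists_nat_ge |X u ω|
        filter_upwards [eventually_ge_atTop N] with M hM
        exact hN.trans (by exact_mod_cast hM)
      measurableSet := fun M => measurableSet_le (hX.measurable u hu).norm measurable_const }
  have hcongr : ∀ M : ℕ, Set.EqOn (fun ω => X u ω ^ 2 * truncPow k M (X u ω))
      (fun ω => |X u ω| ^ (k + 2)) {ω | |X u ω| ≤ M} := fun M ω hω => by
    simp only [truncPow, min_eq_left (show |X u ω| ≤ M from hω)]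
    rw [← sq_abs]; ring
  have hfin := hcov.integrable_of_integral_bounded_of_nonneg_ae
    (f := fun ω => |X u ω| ^ (k + 2)) (K / (1 - ρ / 4 / c ^ 2))
    (fun M => ((hbound M).1.integrableOn).congr_fun (hcongr M) (hcov.measurableSet M))
    (.of_forall fun ω => by positivity)
    (.of_forall fun M => by
      rw [← setIntegral_congr_fun (hcov.measurableSet M) (hcongr M)]
      refine (setIntegral_le_integral (hbound M).1 (.of_forall fun ω => ?_)).trans (hbound M).2
      exact mul_nonneg (sq_nonneg _) (truncPow_nonneg k (Nat.cast_nonneg M) _))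
  refine hfin.mono' ((hX.aesm hu).pow _) (.of_forall fun ω => ?_)
  rw [norm_pow, Real.norm_eq_abs]

/-- All moments are finite. -/
lemma integrable_pow (hq1 : q ≤ 1) (k : ℕ) :
    ∀ t, 0 < t → Integrable (fun ω => X t ω ^ k) μ := by
  induction k with
  | zero => simp
  | succ k ih =>
    rcases k with _ | k
    · intro t ht
      simpa using (hX.memLp t ht).integrable one_le_two
    · exact fun t ht => hX.integrable_pow_succ hq1 k ih ht

lemma integrable_eval (hq1 : q ≤ 1) (P : ℝ[X]) {t : ℝ} (ht : 0 < t) :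
    Integrable (fun ω => P.eval (X t ω)) μ := by
  simpa using integrable_eval_mul_pow (hX.aesm ht) (hX.aesm ht)
    (hX.integrable_pow hq1 P.natDegree t ht) (hX.integrable_pow hq1 P.natDegree t ht) (P := P)
    (i := 0) (by omega)

/-! ### Martingale property in all degrees, and orthogonality. -/

lemma isMartingalePoly (hq1 : q ≤ 1) (n : ℕ) : IsMartingalePoly μ X q η θ τ n := by
  induction n using Nat.strong_induction_on with
  | _ n ih =>
    rcases n with _ | _ | n
    · exact hX.isMartingalePoly_zero
    · exact hX.isMartingalePoly_one
    · exact hX.isMartingalePoly_add_two n (hX.integrable_pow hq1 (n + 2))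
        fun k hk => ih k (by omega)

/-- The mean z of p_{n+2}(X_v) does not depend on v. The recurrence gives E[X_v p_{n+1}(X_t)] = z
plus a multiple of E p_n(X_v), and the left side tends to 0 with v. -/
lemma integral_monicPoly_eq_zero (hq1 : q ≤ 1) (n : ℕ) {t : ℝ} (ht : 0 < t) :
    ∫ ω, (monicPoly q η θ τ (n + 1) t).eval (X t ω) ∂μ = 0 := by
  induction n using Nat.strong_induction_on generalizing t with
  | _ n ih =>
  rcases n with _ | n
  · simpa using hX.mean t ht
  have hi := fun k {v} (hv : 0 < v) => hX.integrable_eval hq1 (monicPoly q η θ τ k v) hv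
  have hmart := hX.isMartingalePoly hq1 (n + 1)
  have hconst : ∀ v, 0 < v → v ≤ t → ∫ ω, (monicPoly q η θ τ (n + 2) v).eval (X v ω) ∂μ
      = ∫ ω, (monicPoly q η θ τ (n + 2) t).eval (X t ω) ∂μ := fun v hv hvt => by
    simpa using (hX.integral_eval_mul_eq (hX.isMartingalePoly hq1 (n + 2)) hv hvt
      (Y := fun _ => 1) stronglyMeasurable_const (hi _ ht) (by simpa using hi _ ht)).symm
  have hZ : MemLp (fun ω => (monicPoly q η θ τ (n + 1) t).eval (X t ω)) 2 μ := by
    refine (memLp_two_iff_integrable_sq (hi _ ht).1).2 ?_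
    have h := hX.integrable_eval hq1 (monicPoly q η θ τ (n + 1) t ^ 2) ht
    simpa only [eval_pow] using h
  have hrec : ∀ v, 0 < v → v ≤ t → ∫ ω, X v ω * (monicPoly q η θ τ (n + 1) t).eval (X t ω) ∂μ
      = ∫ ω, (monicPoly q η θ τ (n + 2) t).eval (X t ω) ∂μ
        + lowCoeff q η θ τ (n + 1) v * ∫ ω, (monicPoly q η θ τ n v).eval (X v ω) ∂μ := by
    intro v hv hvt
    have h1 := hX.integral_eval_mul_eq hmart hv hvt (measurable_past X hv le_rfl).stronglyMeasurable
      (hi _ ht) (hZ.integrable_mul (hX.memLp v hv))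
    have h2 := integral_recurrence (μ := μ) (X := X) (q := q) (η := η) (θ := θ) (τ := τ) (n + 1) v
      (G := fun _ => 1) (by simpa using hi _ hv) (by simpa using hi _ hv) (by simpa using hi _ hv)
    simp only [mul_one, mulAt, ih n (Nat.lt_succ_self n) hv, Nat.add_sub_cancel, mul_zero,
      add_zero, hconst v hv hvt] at h2
    rw [← h2, ← h1]
    congr 1; ext ω; ring
  have hlim := hX.tendsto_integral_mul_zero hZ
  have hmem : ∀ᶠ s in 𝓝[>] (0 : ℝ), s ∈ Set.Ioo 0 t := Ioo_mem_nhdsGT ht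
  have ls : Tendsto (fun s : ℝ => s) (𝓝[>] 0) (𝓝 0) := tendsto_id.mono_left nhdsWithin_le_nhds
  set z := ∫ ω, (monicPoly q η θ τ (n + 2) t).eval (X t ω) ∂μ with hz
  have hlim' : Tendsto (fun s => ∫ ω, X s ω * (monicPoly q η θ τ (n + 1) t).eval (X t ω) ∂μ)
      (𝓝[>] 0) (𝓝 z) := by
    -- For n = 0 the extra term is v·E[1] = v, which vanishes only in the limit; for larger n it is
    -- zero by induction.
    rcases n with _ | n
    · have : Tendsto (fun s : ℝ => z + s) (𝓝[>] 0) (𝓝 (z + 0)) := ls.const_add z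
      rw [add_zero] at this
      refine this.congr' ?_
      filter_upwards [hmem] with s hs
      rw [hrec s hs.1 hs.2.le]
      simp
    · refine tendsto_const_nhds.congr' ?_
      filter_upwards [hmem] with s hs
      rw [hrec s hs.1 hs.2.le, ih n (by omega) hs.1, mul_zero, add_zero]
  exact tendsto_nhds_unique hlim' hlim

lemma integral_pow_mul_monicPoly (hq1 : q ≤ 1) {t : ℝ} (ht : 0 < t) (k : ℕ) :
    ∀ n, k < n → ∫ ω, X t ω ^ k * (monicPoly q η θ τ n t).eval (X t ω) ∂μ = 0 := by
  induction k with
  | zero =>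
    intro n hn
    obtain ⟨n, rfl⟩ : ∃ m, n = m + 1 := ⟨n - 1, by omega⟩
    simpa using hX.integral_monicPoly_eq_zero hq1 n ht
  | succ k ih =>
    intro n hn
    have hi : ∀ j, Integrable (fun ω => (monicPoly q η θ τ j t).eval (X t ω) * X t ω ^ k) μ :=
      fun j => by
        have h := hX.integrable_eval hq1 (monicPoly q η θ τ j t * Polynomial.X ^ k) ht
        simpa only [eval_mul, eval_pow, eval_X] using h
    have h := integral_recurrence (μ := μ) n t (hi _) (hi _) (hi _)
    have h0 : ∀ j, k < j →
        ∫ ω, (monicPoly q η θ τ j t).eval (X t ω) * X t ω ^ k ∂μ = 0 := fun j hj => by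
      rw [← ih j hj]
      congr 1; ext ω; ring
    -- From k + 1 < n all three indices n + 1, n, n - 1 exceed k.
    simp only [mulAt, h0 (n + 1) (by omega), h0 n (by omega), h0 (n - 1) (by omega), mul_zero,
      add_zero] at h
    rw [← h]
    congr 1; ext ω; ring

lemma integral_eval_mul_monicPoly (hq1 : q ≤ 1) {t : ℝ} (ht : 0 < t) {P : ℝ[X]} {n : ℕ}
    (hP : P.natDegree < n) :
    ∫ ω, P.eval (X t ω) * (monicPoly q η θ τ n t).eval (X t ω) ∂μ = 0 := by
  simp only [eval_eq_sum_range (p := P), Finset.sum_mul]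
  rw [integral_finsetSum]
  · refine Finset.sum_eq_zero fun k hk => ?_
    have hk' := Finset.mem_range_succ_iff.1 hk
    simp only [mul_assoc, integral_const_mul,
      hX.integral_pow_mul_monicPoly hq1 ht k n (by omega), mul_zero]
  · intro k _
    have h := hX.integrable_eval hq1
      (C (P.coeff k) * Polynomial.X ^ k * monicPoly q η θ τ n t) ht
    simpa only [eval_mul, eval_pow, eval_X, eval_C] using h

lemma isMonicOrthogonalMartingale (hq1 : q ≤ 1) :
    IsMonicOrthogonalMartingale μ X (monicPoly q η θ τ) where
  monic n t _ := (monicPoly_monic_natDegree q η θ τ n t).1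
  natDegree n t _ := (monicPoly_monic_natDegree q η θ τ n t).2
  integrable n t ht := hX.integrable_eval hq1 _ ht
  martingale n s t hs hst := hX.isMartingalePoly hq1 n s t hs hst
  integrable_mul m n t ht := by
    simpa using hX.integrable_eval hq1 (monicPoly q η θ τ m t * monicPoly q η θ τ n t) ht
  orthogonal m n t ht hmn := by
    rcases lt_or_gt_of_ne hmn with h | h
    · exact hX.integral_eval_mul_monicPoly hq1 ht
        (by rwa [(monicPoly_monic_natDegree q η θ τ m t).2])
    · simp only [mul_comm (eval _ (monicPoly q η θ τ m t))]
      exact hX.integral_eval_mul_monicPoly hq1 ht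
        (by rwa [(monicPoly_monic_natDegree q η θ τ n t).2])

end IsQuadraticHarness
end AllMoments

/-! ### Uniqueness of monic orthogonal polynomials. -/

section Uniqueness

variable {Ω : Type*} [m0 : MeasurableSpace Ω] {μ : Measure Ω}

/-- A polynomial vanishing almost surely at a random variable of infinite support is zero. -/
lemma eq_zero_of_ae_eval_eq_zero {Z : Ω → ℝ} (hZ : Measurable Z)
    (hsupp : (μ.map Z).support.Infinite) {P : ℝ[X]} (h : ∀ᵐ ω ∂μ, P.eval (Z ω) = 0) : P = 0 := by
  by_contra hP
  have hfin : {x | P.IsRoot x}.Finite := finite_setOfPred_isRoot hP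
  refine hsupp (hfin.subset (Measure.support_subset_of_isClosed hfin.isClosed ?_))
  exact (ae_map_iff hZ.aemeasurable hfin.measurableSet).2 h

/-- Monic orthogonal polynomials are orthogonal to all polynomials of lower degree. -/
lemma integral_eval_mul_eq_zero_of_orthogonal {Z : Ω → ℝ}
    (hi : ∀ P : ℝ[X], Integrable (fun ω => P.eval (Z ω)) μ) {p : ℕ → ℝ[X]}
    (hm : ∀ n, (p n).Monic) (hd : ∀ n, (p n).natDegree = n)
    (ho : ∀ m n, m ≠ n → ∫ ω, (p m).eval (Z ω) * (p n).eval (Z ω) ∂μ = 0) {n : ℕ} (d : ℕ) :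
    ∀ P : ℝ[X], P.natDegree < d → d ≤ n → ∫ ω, P.eval (Z ω) * (p n).eval (Z ω) ∂μ = 0 := by
  induction d with
  | zero => intro P hP; omega
  | succ d ih =>
    intro P hP hdn
    set a := P.coeff d
    have hQ : ∫ ω, (P - C a * p d).eval (Z ω) * (p n).eval (Z ω) ∂μ = 0 := by
      -- No `natDegree` lies below 0, so for d = 0 the induction hypothesis is empty; there P is
      -- constant and the remainder is literally zero.
      rcases d with _ | d
      · have hp0 : p 0 = 1 := (hm 0).natDegree_eq_zero.1 (hd 0)
        have hP0 : P = C a := eq_C_of_natDegree_le_zero (by omega)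
        rw [hp0, mul_one, ← hP0, sub_self]
        simp
      · refine ih _ ?_ (by omega)
        refine Nat.lt_succ_of_le (natDegree_le_iff_coeff_eq_zero.2 fun N hN => ?_)
        rcases Nat.lt_or_ge (d + 1) N with h | h
        · rw [coeff_sub, coeff_C_mul, coeff_eq_zero_of_natDegree_lt (by omega),
            coeff_eq_zero_of_natDegree_lt (by rw [hd]; omega), mul_zero, sub_zero]
        · obtain rfl : N = d + 1 := by omega
          have : (p (d + 1)).coeff (d + 1) = 1 := by
            simpa [hd] using (hm (d + 1)).coeff_natDegree
          rw [coeff_sub, coeff_C_mul, this, mul_one, sub_self]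
    have i1 : Integrable (fun ω => (P - C a * p d).eval (Z ω) * (p n).eval (Z ω)) μ := by
      simpa using hi ((P - C a * p d) * p n)
    have i2 : Integrable (fun ω => (p d).eval (Z ω) * (p n).eval (Z ω)) μ := by
      simpa using hi (p d * p n)
    have e : ∫ ω, P.eval (Z ω) * (p n).eval (Z ω) ∂μ
        = ∫ ω, (P - C a * p d).eval (Z ω) * (p n).eval (Z ω)
          + a * ((p d).eval (Z ω) * (p n).eval (Z ω)) ∂μ := by
      congr 1; ext ω
      simp only [eval_sub, eval_mul, eval_C]
      ring
    rw [e, integral_add i1 (i2.const_mul a), hQ, integral_const_mul, ho d n (by omega), mul_zero,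
      add_zero]

/-- Monic orthogonal polynomials for a law of infinite support are unique. -/
lemma monic_orthogonal_unique {Z : Ω → ℝ} (hZ : Measurable Z)
    (hsupp : (μ.map Z).support.Infinite)
    (hi : ∀ P : ℝ[X], Integrable (fun ω => P.eval (Z ω)) μ) {p p' : ℕ → ℝ[X]}
    (hm : ∀ n, (p n).Monic) (hd : ∀ n, (p n).natDegree = n)
    (ho : ∀ m n, m ≠ n → ∫ ω, (p m).eval (Z ω) * (p n).eval (Z ω) ∂μ = 0)
    (hm' : ∀ n, (p' n).Monic) (hd' : ∀ n, (p' n).natDegree = n)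
    (ho' : ∀ m n, m ≠ n → ∫ ω, (p' m).eval (Z ω) * (p' n).eval (Z ω) ∂μ = 0) (n : ℕ) :
    p n = p' n := by
  rcases n with _ | n
  · rw [(hm 0).natDegree_eq_zero.1 (hd 0), (hm' 0).natDegree_eq_zero.1 (hd' 0)]
  -- The leading terms cancel, so D is orthogonal to both polynomials, hence to itself.
  set D := p (n + 1) - p' (n + 1) with hD
  have hdeg : D.natDegree < n + 1 := by
    refine Nat.lt_succ_of_le (natDegree_le_iff_coeff_eq_zero.2 fun N hN => ?_)
    rcases Nat.lt_or_ge (n + 1) N with h | h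
    · rw [coeff_sub, coeff_eq_zero_of_natDegree_lt (by rw [hd]; omega),
        coeff_eq_zero_of_natDegree_lt (by rw [hd']; omega), sub_zero]
    · obtain rfl : N = n + 1 := by omega
      have h1 : (p (n + 1)).coeff (n + 1) = 1 := by simpa [hd] using (hm (n + 1)).coeff_natDegree
      have h2 : (p' (n + 1)).coeff (n + 1) = 1 := by
        simpa [hd'] using (hm' (n + 1)).coeff_natDegree
      rw [coeff_sub, h1, h2, sub_self]
  have o1 := integral_eval_mul_eq_zero_of_orthogonal hi hm hd ho (n + 1) D hdeg le_rfl
  have o2 := integral_eval_mul_eq_zero_of_orthogonal hi hm' hd' ho' (n + 1) D hdeg le_rfl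
  have i1 : Integrable (fun ω => D.eval (Z ω) * (p (n + 1)).eval (Z ω)) μ := by
    simpa using hi (D * p (n + 1))
  have i2 : Integrable (fun ω => D.eval (Z ω) * (p' (n + 1)).eval (Z ω)) μ := by
    simpa using hi (D * p' (n + 1))
  have hsq : ∫ ω, D.eval (Z ω) ^ 2 ∂μ = 0 := by
    have e : ∫ ω, D.eval (Z ω) ^ 2 ∂μ = ∫ ω, D.eval (Z ω) * (p (n + 1)).eval (Z ω)
        - D.eval (Z ω) * (p' (n + 1)).eval (Z ω) ∂μ := by
      congr 1; ext ω
      rw [sq, ← mul_sub, ← eval_sub]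
    rw [e, integral_sub i1 i2, o1, o2, sub_zero]
  have hi2 := hi (D ^ 2)
  simp only [eval_pow] at hi2
  have hae := (integral_eq_zero_iff_of_nonneg (fun ω => sq_nonneg _) hi2).1 hsq
  refine sub_eq_zero.1 (eq_zero_of_ae_eval_eq_zero hZ hsupp ?_)
  filter_upwards [hae] with ω hω
  simpa only [Pi.zero_apply, pow_eq_zero_iff two_ne_zero] using hω

end Uniqueness

/-! ### The recurrence as a characterization of the family. -/

section Recurrence

variable {Ω : Type*} [m0 : MeasurableSpace Ω] {μ : Measure Ω} {X : ℝ → Ω → ℝ}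

lemma IsMonicOrthogonalMartingale.congr {p p' : ℕ → ℝ → ℝ[X]}
    (hp : IsMonicOrthogonalMartingale μ X p) (h : ∀ n t, 0 < t → p' n t = p n t) :
    IsMonicOrthogonalMartingale μ X p' where
  monic n t ht := by rw [h n t ht]; exact hp.monic n t ht
  natDegree n t ht := by rw [h n t ht]; exact hp.natDegree n t ht
  integrable n t ht := by rw [h n t ht]; exact hp.integrable n t ht
  martingale n s t hs hst := by
    rw [h n t (hs.trans hst), h n s hs]; exact hp.martingale n s t hs hst
  integrable_mul m n t ht := by rw [h n t ht, h m t ht]; exact hp.integrable_mul m n t ht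
  orthogonal m n t ht hmn := by rw [h n t ht, h m t ht]; exact hp.orthogonal m n t ht hmn

lemma eq_monicPoly_iff (q η θ τ : ℝ) (p : ℕ → ℝ[X]) (t : ℝ) :
    (∀ n, p n = monicPoly q η θ τ n t) ↔ p 0 = 1 ∧ p 1 = Polynomial.X ∧
      ∀ n : ℕ, 1 ≤ n → Polynomial.X * p n = p (n + 1) + C (diagCoeff q η θ τ n t) * p n
        + C (lowCoeff q η θ τ n t) * p (n - 1) := by
  constructor
  · intro h
    simp only [h, monicPoly_zero, monicPoly_one, true_and]
    exact fun n _ => X_mul_monicPoly q η θ τ n t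
  · rintro ⟨h0, h1, hrec⟩ n
    induction n using Nat.strong_induction_on with
    | _ n ih =>
      rcases n with _ | _ | n
      · simpa using h0
      · simpa using h1
      · have h := hrec (n + 1) (by omega)
        rw [Nat.add_sub_cancel, ih (n + 1) (by omega), ih n (by omega)] at h
        rw [monicPoly, h]
        ring

end Recurrence

end QuadraticHarness

end

theorem theorem4p9 {Ω : Type*} [MeasurableSpace Ω] (μ : Measure Ω) [IsProbabilityMeasure μ]
    (X : ℝ → Ω → ℝ) (q η θ τ : ℝ)
    (hX : QuadraticHarness.IsQuadraticHarness μ X q η θ 0 τ)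
    (hq : -1 < q) (hq1 : q ≤ 1)
    (hpos : ∀ n : ℕ, 0 < 1 + QuadraticHarness.qNum q n * η * θ
      + QuadraticHarness.qNum q n ^ 2 * τ * η ^ 2)
    (hsupp : ∀ t, 0 < t → (μ.map (X t)).support.Infinite) :
    (∀ t, 0 < t → ∀ k : ℕ, Integrable (fun ω => X t ω ^ k) μ) ∧
    (∃ p : ℕ → ℝ → ℝ[X], QuadraticHarness.IsMonicOrthogonalMartingale μ X p) ∧
    ∀ p : ℕ → ℝ → ℝ[X], QuadraticHarness.IsMonicOrthogonalMartingale μ X p ↔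
      ∀ t, 0 < t → p 0 t = 1 ∧ p 1 t = Polynomial.X ∧
        ∀ n : ℕ, 1 ≤ n →
          Polynomial.X * p n t = p (n + 1) t
            + C ((η * t + θ
                + (QuadraticHarness.qNum q n + QuadraticHarness.qNum q (n - 1)) * η * τ)
                * QuadraticHarness.qNum q n) * p n t
            + C ((t + τ * QuadraticHarness.qNum q (n - 1))
                * (1 + QuadraticHarness.qNum q (n - 1) * η * θ
                    + QuadraticHarness.qNum q (n - 1) ^ 2 * τ * η ^ 2)
                * QuadraticHarness.qNum q n) * p (n - 1) t := by
  have heq : ∀ p : ℕ → ℝ → ℝ[X], QuadraticHarness.IsMonicOrthogonalMartingale μ X p ↔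
      ∀ t, 0 < t → ∀ n, p n t = QuadraticHarness.monicPoly q η θ τ n t := by
    intro p
    have hm := hX.isMonicOrthogonalMartingale hq1
    refine ⟨fun hp t ht n => ?_, fun h => hm.congr fun n t ht => h t ht n⟩
    exact QuadraticHarness.monic_orthogonal_unique (hX.measurable t ht) (hsupp t ht)
      (fun P => hX.integrable_eval hq1 P ht) (p := fun n => p n t)
      (p' := fun n => QuadraticHarness.monicPoly q η θ τ n t)
      (fun n => hp.monic n t ht) (fun n => hp.natDegree n t ht)
      (fun m n h => hp.orthogonal m n t ht h) (fun n => hm.monic n t ht)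
      (fun n => hm.natDegree n t ht) (fun m n h => hm.orthogonal m n t ht h) n
  refine ⟨fun t ht k => hX.integrable_pow hq1 k t ht,
    ⟨_, hX.isMonicOrthogonalMartingale hq1⟩, fun p => (heq p).trans ?_⟩
  exact forall₂_congr fun t _ =>
    QuadraticHarness.eq_monicPoly_iff q η θ τ (fun n => p n t) t
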